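/- Let $m\ge 3$ and $k\ge 0$ be integers and $\mu=\frac m2-1$. Let $\mathcal{C}\ell_m$ be the Clifford algebra with complex coefficients generated by $e_1,\dots,e_m$ with $e_je_l+e_le_j=-2\delta_{jl}$, and let $X\mapsto X^\dagger$ be the antilinear (complex conjugation on coefficients) anti-automorphism with $e_j^\dagger=-e_j$. For $x,y\in\mathbb R^m$ write $\langle x,y\rangle=\sum_j x_jy_j$, $|x|=\sqrt{\langle x,x\rangle}$, $t=\frac{\langle x,y\rangle}{|x||y|}$, $\underline x=\sum_j e_jx_j$ and $\underline x\wedge\underline y=\sum_{j<l}e_je_l(x_jy_l-x_ly_j)$. The Dirac operator $\partial_{\underline x}=\sum_j e_j\partial_{x_j}$ acts on $\mathcal{C}\ell_m$-valued functions from the left by $\partial_{\underline x}f=\sum_j e_j\,\partial_{x_j}f$ and from the right by $f\partial_{\underline x}=\sum_j(\partial_{x_j}f)\,e_j$. Let $\mathcal M_l$ be the space of spherical monogenics of degree $l$, i.e. of $\mathcal{C}\ell_m$-valued homogeneous polynomials $M$ of degree $l$ on $\mathbb R^m$ with $\partial_{\underline x}M=0$, and put $$\langle P,Q\rangle_{\mathbb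 S^{m-1}}=\frac1{\omega_{m-1}}\int_{\mathbb S^{m-1}}P(x)^\dagger Q(x)\,d\sigma(x),\qquad \omega_{m-1}=\frac{2\pi^{m/2}}{\Gamma(m/2)},$$ where $\sigma$ is the surface measure. For $\nu>0$ let $$C_k^\nu(t)=\sum_{j=0}^{\lfloor k/2\rfloor}(-1)^j\frac{\Gamma(k-j+\nu)}{\Gamma(\nu)\,j!\,(k-2j)!}(2t)^{k-2j}$$ be the Gegenbauer polynomial, with $C_{-1}^\nu=0$, and let $K_k^m(x,y)=\frac{k+\mu}{\mu}|x|^k|y|^kC_k^\mu(t)$ be the reproducing kernel of the spherical harmonics of degree $k$. (Expressions of the form $|x|^k|y|^kC_k^\nu(t)$ are polynomials in $x$ and $y$ and are read as such when $x=0$ or $y=0$.) Define $$\widetilde K_k^m(x,y)=-\frac1{(m+2k)^2}\,\partial_{\underline x}K_{k+1}^m(x,y)\,\partial_{\underline y},$$ where $\partial_{\underline x}$ acts from the left and $\partial_{\underline y}$ from the right. Then: 1. For all $x,y\in\mathbb R^m$, $$\widetilde K_k^m(x,y)=\frac{2\mu+k}{2\mu}|x|^k|y|^kC_k^\mu(t)+(\underline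 x\wedge\underline y)\,|x|^{k-1}|y|^{k-1}C_{k-1}^{\mu+1}(t).$$ 2. $\widetilde K_k^m$ is a reproducing kernel of $\mathcal M_k$: for every $y\in\mathbb R^m$ one has $\widetilde K_k^m(\cdot,y)\in\mathcal M_k$, and for every $l\ge 0$ and every $M_l\in\mathcal M_l$, $$\langle\widetilde K_k^m(\cdot,y),M_l\rangle_{\mathbb S^{m-1}}=\delta_{kl}\,M_l(y).$$ 3. For every $y\in\mathbb R^m$, every $l\ge 0$ and every $M_l\in\mathcal M_l$, $$\langle\widetilde K_k^m(\cdot,y),\underline x\,M_l\rangle_{\mathbb S^{m-1}}=0.$$ -/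

import Mathlib

open scoped TensorProduct
open MeasureTheory

noncomputable section

namespace CliffordAnalysis

/-- Euclidean space `ℝ^m`, with `|x| = ‖x‖` the Euclidean norm. -/
abbrev E (m : ℕ) : Type := EuclideanSpace ℝ (Fin m)

/-- The quadratic form `v ↦ -∑ j, (v j)^2` on `ℝ^m`. -/
def negForm (m : ℕ) : QuadraticForm ℝ (Fin m → ℝ) :=
  QuadraticMap.weightedSumSquares ℝ (fun _ : Fin m => (-1 : ℝ))

/-- The Clifford conjugation of the real Clifford algebra (Mathlib's `star`, the anti-automorphism
with `e_j ↦ -e_j`) is real-linear. -/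
instance instStarModuleReal (m : ℕ) : StarModule ℝ (CliffordAlgebra (negForm m)) where
  star_smul r x := by simp

/-- The Clifford algebra with complex coefficients, generated by `e_1, …, e_m` subject to
`e_j e_k + e_k e_j = -2 δ_{jk}`.  Its `star`, inherited from the two tensor factors, is complex
conjugation of the coefficients combined with the anti-automorphism `e_j ↦ -e_j`; this is the
conjugation `X ↦ X†`. -/
abbrev Cl (m : ℕ) : Type := ℂ ⊗[ℝ] CliffordAlgebra (negForm m)

/-- The generator `e_j`. -/
def e {m : ℕ} (j : Fin m) : Cl m :=
  (1 : ℂ) ⊗ₜ[ℝ] CliffordAlgebra.ι (negForm m) (Pi.single j 1)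

theorem e_mul_e_add {m : ℕ} (j k : Fin m) :
    e j * e k + e k * e j = if j = k then (-2 : Cl m) else 0 := by
  have h : CliffordAlgebra.ι (negForm m) (Pi.single j 1) *
      CliffordAlgebra.ι (negForm m) (Pi.single k 1) +
      CliffordAlgebra.ι (negForm m) (Pi.single k 1) *
      CliffordAlgebra.ι (negForm m) (Pi.single j 1) =
      algebraMap ℝ _ (if j = k then -2 else 0) := by
    rw [CliffordAlgebra.ι_mul_ι_add_swap]
    congr 1
    by_cases hjk : j = k
    · subst hjk
      rw [QuadraticMap.polar_self]
      simp [negForm, QuadraticMap.weightedSumSquares_apply, Pi.single_apply]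
    · simp only [QuadraticMap.polar, negForm, QuadraticMap.weightedSumSquares_apply, Pi.add_apply,
        Pi.single_apply, smul_eq_mul, if_neg hjk]
      rw [← Finset.sum_sub_distrib, ← Finset.sum_sub_distrib]
      refine Finset.sum_eq_zero fun i _ => ?_
      by_cases h1 : i = j
      · simp [h1, hjk]
      · simp [h1]
  unfold e
  rw [Algebra.TensorProduct.tmul_mul_tmul, Algebra.TensorProduct.tmul_mul_tmul, one_mul,
    ← TensorProduct.tmul_add, h]
  split_ifs
  · have h2 : algebraMap ℝ (CliffordAlgebra (negForm m)) (-2) = (-2 : ℝ) • 1 :=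
      Algebra.algebraMap_eq_smul_one _
    rw [h2, TensorProduct.tmul_smul, ← Algebra.TensorProduct.one_def, neg_smul, ofNat_smul_eq_nsmul]
    simp
  · simp

theorem star_e {m : ℕ} (j : Fin m) : star (e j) = -e j := by
  simp [e, TensorProduct.tmul_neg]

theorem star_complex_smul {m : ℕ} (z : ℂ) (X : Cl m) :
    star (z • X) = (starRingEnd ℂ z) • star X := by
  induction X using TensorProduct.induction_on with
  | zero => simp
  | tmul w a => simp [TensorProduct.smul_tmul']
  | add a b ha hb => simp [ha, hb]

instance instFiniteReal (m : ℕ) : Module.Finite ℝ (CliffordAlgebra (negForm m)) := by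
  have : Invertible (2 : ℝ) := invertibleOfNonzero two_ne_zero
  have : Module.Finite ℝ (ExteriorAlgebra ℝ (Fin m → ℝ)) :=
    Module.Finite.of_basis (Pi.basisFun ℝ (Fin m)).ExteriorAlgebra
  exact Module.Finite.equiv (CliffordAlgebra.equivExterior (negForm m)).symm

/-- A norm on the finite-dimensional real vector space `Cl m` (the sup norm of the coordinates in
some basis).  Derivatives and integrals of `Cl m`-valued functions are coordinatewise; they do not
depend on which norm is used, all norms on `Cl m` being equivalent. -/
instance instNorm (m : ℕ) : NormedAddCommGroup (Cl m) :=
  NormedAddCommGroup.induced (Cl m) (Fin (Module.finrank ℝ (Cl m)) → ℝ)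
    (Module.finBasis ℝ (Cl m)).equivFun.toLinearMap
    (Module.finBasis ℝ (Cl m)).equivFun.injective

instance instNormedSpace (m : ℕ) : NormedSpace ℝ (Cl m) :=
  NormedSpace.induced ℝ (Cl m) (Fin (Module.finrank ℝ (Cl m)) → ℝ)
    (Module.finBasis ℝ (Cl m)).equivFun.toLinearMap

/-- The Clifford vector `∑ j, x_j e_j` of `x ∈ ℝ^m`. -/
def vec {m : ℕ} (x : E m) : Cl m := ∑ j, x j • e j

/-- The bivector `x ∧ y = ∑_{j<k} e_j e_k (x_j y_k - x_k y_j)`. -/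
def wedge {m : ℕ} (x y : E m) : Cl m :=
  ∑ j : Fin m, ∑ k ∈ Finset.Ioi j, (x j * y k - x k * y j) • (e j * e k)

/-- The partial derivative `∂_{x_j} f`. -/
def partialDeriv {m : ℕ} (j : Fin m) (f : E m → Cl m) (x : E m) : Cl m :=
  lineDeriv ℝ f x (EuclideanSpace.single j 1)

/-- The Dirac operator acting from the left: `∑ j, e_j ∂_{x_j} f`. -/
def diracLeft {m : ℕ} (f : E m → Cl m) (x : E m) : Cl m :=
  ∑ j, e j * partialDeriv j f x

/-- The Dirac operator acting from the right: `∑ j, (∂_{x_j} f) e_j`. -/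
def diracRight {m : ℕ} (f : E m → Cl m) (x : E m) : Cl m :=
  ∑ j, partialDeriv j f x * e j

/-- `Cl m`-valued homogeneous polynomials of degree `k`: finite sums of `x^α p_α` with
`α ∈ ℕ^m`, `|α| = k` and `p_α ∈ Cl m`. -/
def IsHomogeneousPolynomial {m : ℕ} (k : ℕ) (P : E m → Cl m) : Prop :=
  ∃ p : (Fin m → ℕ) → Cl m, ∀ x : E m,
    P x = ∑ α ∈ Finset.piAntidiag (Finset.univ : Finset (Fin m)) k, (∏ j, x j ^ α j) • p α

/-- `M` is a spherical monogenic of degree `k`: a homogeneous polynomial of degree `k` with values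
in `Cl m` that is annihilated by the left Dirac operator. -/
def IsSphericalMonogenic {m : ℕ} (k : ℕ) (M : E m → Cl m) : Prop :=
  IsHomogeneousPolynomial k M ∧ ∀ x, diracLeft M x = 0

/-- The surface area `2 π^(m/2) / Γ(m/2)` of the unit sphere of `ℝ^m`. -/
def sphereArea (m : ℕ) : ℝ := 2 * Real.pi ^ ((m : ℝ) / 2) / Real.Gamma ((m : ℝ) / 2)

/-- The `Cl m`-valued inner product `ω⁻¹ ∫ P(x)† Q(x) dσ(x)` over the unit sphere, where `σ` is the
surface measure and `ω` the surface area. -/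
def sphereInner {m : ℕ} (P Q : E m → Cl m) : Cl m :=
  (sphereArea m)⁻¹ •
    ∫ x : Metric.sphere (0 : E m) 1, star (P x) * Q x ∂((volume : Measure (E m)).toSphere)

/-- The Gegenbauer polynomial `C_k^μ(t)`, for `μ > 0`. -/
def gegenbauer (k : ℕ) (μ t : ℝ) : ℝ :=
  ∑ j ∈ Finset.range (k / 2 + 1),
    (-1) ^ j * (Real.Gamma ((k : ℝ) - j + μ) /
      (Real.Gamma μ * (j.factorial : ℝ) * ((k - 2 * j).factorial : ℝ))) * (2 * t) ^ (k - 2 * j)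

/-- The parameter `μ = m/2 - 1`. -/
def mu (m : ℕ) : ℝ := (m : ℝ) / 2 - 1

/-- The variable `t = ⟨x, y⟩ / (|x| |y|)`. -/
def angle {m : ℕ} (x y : E m) : ℝ := inner ℝ x y / (‖x‖ * ‖y‖)

/-- The reproducing kernel of the spherical harmonics of degree `k`,
`K_k(x, y) = (k + μ)/μ |x|^k |y|^k C_k^μ(t)`. -/
def harmonicKernel {m : ℕ} (k : ℕ) (x y : E m) : ℝ :=
  ((k : ℝ) + mu m) / mu m * ‖x‖ ^ k * ‖y‖ ^ k * gegenbauer k (mu m) (angle x y)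

/-- The kernel `c_k ∂_x K_{k+1}(x, y) ∂_y` with `c_k = -(m + 2k)^(-2)`: the Dirac operator in `x`
acts from the left, the Dirac operator in `y` from the right. -/
def monogenicKernel {m : ℕ} (k : ℕ) (x y : E m) : Cl m :=
  (-(1 / ((m : ℝ) + 2 * k) ^ 2)) •
    diracRight (fun y' : E m =>
      diracLeft (fun x' : E m => algebraMap ℝ (Cl m) (harmonicKernel (k + 1) x' y')) x) y

/-- The coefficient `|x|^(k-1) |y|^(k-1) C_{k-1}^(μ+1)(t)` of the bivector `x ∧ y`; it is zero for
`k = 0`, by the convention `C_{-1} = 0`. -/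
def bivectorCoeff {m : ℕ} : ℕ → E m → E m → ℝ
  | 0, _, _ => 0
  | k + 1, x, y => ‖x‖ ^ k * ‖y‖ ^ k * gegenbauer k (mu m + 1) (angle x y)

end CliffordAnalysis

end

open CliffordAnalysis

/-! Write `Z_n^ν = |x|^n |y|^n C_n^ν(t)`. Everything rests on the closed form `Z_k^{μ+1} +
Z_{k-1}^{μ+1} x y` of the kernel, with a Clifford product `x y` (`monogenicKernel_eq`). It comes
from differentiating `K_{k+1}` in `x` and then in `y` and simplifying with Gegenbauer identities.
Splitting `x y` into scalar and bivector parts gives the first claim, and a second such computation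
gives monogenicity.

For the integrals, the components of a spherical monogenic `M` are harmonic because the Dirac
operator squares to minus the Laplacian; those of `x M` are harmonic because `Δ(x M) = x ΔM + 2 ∂M`.
Against a harmonic `H` of degree `l`, the function `Z_n^{μ+1}` has sphere mean `|y|^{n-l} H(y)` if
`n - l` is even and nonnegative, and zero otherwise (`sphereMean_zonal_add_one_mul`). Conjugation
turns `x y` into `y x`, so pairing the kernel with `M` gives two such means whose difference
telescopes to `δ_{kl} M(y)`. Pairing with `x M` uses `x x M = -M` on the sphere, and the two means
cancel.

The scalar formula follows from `(n+μ) Z_n^μ = μ (Z_n^{μ+1} - |x|²|y|² Z_{n-2}^{μ+1})` by induction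
on `n`, given that `Z_n^μ` is harmonic, orthogonal to other degrees and reproducing in its own.
Orthogonality and reproduction come from Green's formula on the sphere, obtained by integrating by
parts against a Gaussian. -/

noncomputable section

namespace CliffordAnalysis

/-! ### Homogenized Gegenbauer polynomials and their identities -/

section GegenbauerForm

/-- The coefficient of `s ^ i * p ^ j` in `gegenbauerForm`. -/
def gegenbauerCoeff (ν : ℝ) (i j : ℕ) : ℝ :=
  (-1) ^ j * 2 ^ i * (Real.Gamma (i + j + ν) /
    (Real.Gamma ν * (j.factorial : ℝ) * (i.factorial : ℝ)))

/-- This and the next two relations are `Γ(z+1) = zΓ(z)` and the factorial recursion; every identity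
below is assembled from them term by term. -/
theorem mul_gegenbauerCoeff_add_one {ν : ℝ} (hν : 0 < ν) (i j : ℕ) :
    ν * gegenbauerCoeff (ν + 1) i j = (i + j + ν) * gegenbauerCoeff ν i j := by
  have h1 : (i : ℝ) + j + (ν + 1) = (i + j + ν) + 1 := by ring
  have h2 : (i : ℝ) + j + ν ≠ 0 := by positivity
  have h3 := (Real.Gamma_pos_of_pos hν).ne'
  rw [gegenbauerCoeff, gegenbauerCoeff, h1, Real.Gamma_add_one h2, Real.Gamma_add_one hν.ne']
  field_simp

theorem mul_gegenbauerCoeff_left {ν : ℝ} (hν : 0 < ν) (i j : ℕ) :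
    (i + 1) * gegenbauerCoeff ν (i + 1) j = 2 * ν * gegenbauerCoeff (ν + 1) i j := by
  have h1 : ((i + 1 : ℕ) : ℝ) + j + ν = i + j + (ν + 1) := by push_cast; ring
  have h3 := (Real.Gamma_pos_of_pos hν).ne'
  rw [gegenbauerCoeff, gegenbauerCoeff, h1, Real.Gamma_add_one hν.ne', Nat.factorial_succ]
  push_cast
  field_simp
  ring

theorem mul_gegenbauerCoeff_right {ν : ℝ} (hν : 0 < ν) (i j : ℕ) :
    (j + 1) * gegenbauerCoeff ν i (j + 1) = -ν * gegenbauerCoeff (ν + 1) i j := by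
  have h1 : (i : ℝ) + (j + 1 : ℕ) + ν = i + j + (ν + 1) := by push_cast; ring
  have h3 := (Real.Gamma_pos_of_pos hν).ne'
  rw [gegenbauerCoeff, gegenbauerCoeff, h1, Real.Gamma_add_one hν.ne', Nat.factorial_succ]
  push_cast
  field_simp
  ring

variable {R : Type*} [CommRing R] [Algebra ℝ R]

/-- The term of `gegenbauerForm` of degree `i` in `s` and `j` in `p`; zero for negative `i`. -/
def gegenbauerTerm (ν : ℝ) (s p : R) (i : ℤ) (j : ℕ) : R :=
  if 0 ≤ i then gegenbauerCoeff ν i.toNat j • (s ^ i.toNat * p ^ j) else 0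

/-- The homogenized Gegenbauer polynomial: a polynomial in `s` and `p` with value
`r ^ n * C_n^ν(t)` at `s = r * t`, `p = r ^ 2`.  It is zero for negative `n`. -/
def gegenbauerForm (ν : ℝ) (n : ℤ) (s p : R) : R :=
  ∑ j ∈ Finset.range (n.toNat + 1), gegenbauerTerm ν s p (n - 2 * j) j

theorem gegenbauerTerm_natCast (ν : ℝ) (s p : R) (i j : ℕ) :
    gegenbauerTerm ν s p i j = gegenbauerCoeff ν i j • (s ^ i * p ^ j) := if_pos (by lia)

theorem gegenbauerTerm_of_neg (ν : ℝ) (s p : R) {i : ℤ} (hi : i < 0) (j : ℕ) :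
    gegenbauerTerm ν s p i j = 0 := if_neg (not_le.2 hi)

theorem gegenbauerForm_of_neg (ν : ℝ) (s p : R) {n : ℤ} (hn : n < 0) :
    gegenbauerForm ν n s p = 0 :=
  Finset.sum_eq_zero fun j _ => gegenbauerTerm_of_neg _ _ _ (by lia) _

theorem gegenbauerForm_zero {ν : ℝ} (hν : 0 < ν) (s p : R) : gegenbauerForm ν 0 s p = 1 := by
  simp [gegenbauerForm, gegenbauerTerm, gegenbauerCoeff, (Real.Gamma_pos_of_pos hν).ne']

/-- Terms past the cutoff have negative degree in `s` and vanish. The free choice of `N` lets sums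
of index `n`, `n - 1` and `n - 2` be compared over matching ranges. -/
theorem gegenbauerForm_eq_sum (ν : ℝ) (s p : R) {n : ℤ} {N : ℕ} (hN : n < 2 * N) :
    gegenbauerForm ν n s p = ∑ j ∈ Finset.range N, gegenbauerTerm ν s p (n - 2 * j) j := by
  rw [gegenbauerForm]
  rcases le_total N (n.toNat + 1) with h | h
  · symm
    refine Finset.sum_subset (by simpa using h) fun j _ hj => ?_
    exact gegenbauerTerm_of_neg _ _ _ (by simp at hj; lia) _
  · refine Finset.sum_subset (by simpa using h) fun j _ hj => ?_
    exact gegenbauerTerm_of_neg _ _ _ (by simp at hj; lia) _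

theorem map_gegenbauerForm {S : Type*} [CommRing S] [Algebra ℝ S] (f : R →ₐ[ℝ] S) (ν : ℝ) (n : ℤ)
    (s p : R) : f (gegenbauerForm ν n s p) = gegenbauerForm ν n (f s) (f p) := by
  simp only [gegenbauerForm, map_sum]
  refine Finset.sum_congr rfl fun j _ => ?_
  unfold gegenbauerTerm
  split_ifs <;> simp

variable {ν : ℝ} (s p : R)

theorem smul_gegenbauerTerm_add_one (hν : 0 < ν) (i : ℤ) (j : ℕ) :
    ν • gegenbauerTerm (ν + 1) s p i j = (i + j + ν) • gegenbauerTerm ν s p i j := by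
  rcases lt_or_ge i 0 with hi | hi
  · simp [gegenbauerTerm_of_neg _ _ _ hi]
  · lift i to ℕ using hi
    simp only [gegenbauerTerm_natCast, smul_smul, mul_gegenbauerCoeff_add_one hν, Int.cast_natCast]

theorem smul_gegenbauerTerm_left (hν : 0 < ν) (i : ℤ) (j : ℕ) :
    (i : ℝ) • gegenbauerTerm ν s p i j = (2 * ν) • (s * gegenbauerTerm (ν + 1) s p (i - 1) j) := by
  rcases lt_trichotomy i 0 with hi | rfl | hi
  · rw [gegenbauerTerm_of_neg _ _ _ hi, gegenbauerTerm_of_neg _ _ _ (by lia)]; simp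
  · rw [gegenbauerTerm_of_neg (ν + 1) _ _ (by simp)]; simp
  · obtain ⟨i, rfl⟩ : ∃ k : ℕ, i = (k + 1 : ℕ) := ⟨(i - 1).toNat, by lia⟩
    have e2 : ((i + 1 : ℕ) : ℤ) - 1 = i := by lia
    rw [e2]
    simp only [gegenbauerTerm_natCast, mul_smul_comm, smul_smul, ← mul_gegenbauerCoeff_left hν]
    push_cast
    rw [pow_succ' s i, mul_assoc]

theorem smul_gegenbauerTerm_right (hν : 0 < ν) (i : ℤ) (j : ℕ) :
    (j + 1 : ℝ) • gegenbauerTerm ν s p i (j + 1) =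
      (-ν) • (p * gegenbauerTerm (ν + 1) s p i j) := by
  rcases lt_or_ge i 0 with hi | hi
  · simp [gegenbauerTerm_of_neg _ _ _ hi]
  · lift i to ℕ using hi
    simp only [gegenbauerTerm_natCast, mul_smul_comm, smul_smul, mul_gegenbauerCoeff_right hν]
    rw [pow_succ' p j, mul_left_comm]

theorem derivation_gegenbauerTerm (hν : 0 < ν) (D : Derivation ℝ R R) (i : ℤ) (j : ℕ) :
    D (gegenbauerTerm ν s p i j) = (2 * ν) • (gegenbauerTerm (ν + 1) s p (i - 1) j * D s) +
      (-ν) • (if j = 0 then 0 else gegenbauerTerm (ν + 1) s p i (j - 1) * D p) := by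
  rcases lt_or_ge i 0 with hi | hi
  · simp [gegenbauerTerm_of_neg _ _ _ hi, gegenbauerTerm_of_neg _ _ _ (show i - 1 < 0 by lia)]
  · lift i to ℕ using hi
    have hs : gegenbauerCoeff ν i j • (p ^ j * D (s ^ i)) =
        (2 * ν) • (gegenbauerTerm (ν + 1) s p (i - 1) j * D s) := by
      rcases i with _ | i
      · simp [gegenbauerTerm_of_neg]
      · have e2 : ((i + 1 : ℕ) : ℤ) - 1 = i := by lia
        rw [e2, gegenbauerTerm_natCast, smul_mul_assoc, smul_smul, ← mul_gegenbauerCoeff_left hν,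
          Derivation.leibniz_pow, mul_comm ((i : ℝ) + 1), mul_smul]
        congr 1
        rw [← Nat.cast_smul_eq_nsmul ℝ]
        push_cast
        simp only [smul_eq_mul, mul_smul_comm]
        congr 1
        ring
    have hp : gegenbauerCoeff ν i j • (s ^ i * D (p ^ j)) =
        (-ν) • (if j = 0 then 0 else gegenbauerTerm (ν + 1) s p i (j - 1) * D p) := by
      rcases j with _ | j
      · simp
      · rw [if_neg (by lia), Nat.add_sub_cancel, gegenbauerTerm_natCast, smul_mul_assoc, smul_smul,
          ← mul_gegenbauerCoeff_right hν, Derivation.leibniz_pow, mul_comm ((j : ℝ) + 1), mul_smul]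
        congr 1
        rw [← Nat.cast_smul_eq_nsmul ℝ]
        push_cast
        simp only [smul_eq_mul, mul_smul_comm]
        congr 1
        ring
    rw [← hs, ← hp, gegenbauerTerm_natCast, D.map_smul, Derivation.leibniz, add_comm, smul_add]
    simp only [smul_eq_mul]

/-- Chain rule: `∂_s` raises the parameter and lowers the index by one, `∂_p` raises the parameter
and lowers the index by two. -/
theorem derivation_gegenbauerForm (hν : 0 < ν) (D : Derivation ℝ R R) (n : ℤ) :
    D (gegenbauerForm ν n s p) = (2 * ν) • (gegenbauerForm (ν + 1) (n - 1) s p * D s) -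
      ν • (gegenbauerForm (ν + 1) (n - 2) s p * D p) := by
  have h0 : n < 2 * (n.toNat + 1 : ℕ) := by lia
  have h1 : n - 1 < 2 * (n.toNat + 1 : ℕ) := by lia
  have h2 : n - 2 < 2 * (n.toNat : ℕ) := by lia
  rw [gegenbauerForm_eq_sum _ _ _ h0, gegenbauerForm_eq_sum _ _ _ h1,
    gegenbauerForm_eq_sum _ _ _ h2, map_sum, Finset.sum_mul, Finset.sum_mul, sub_eq_add_neg,
    ← neg_smul, Finset.smul_sum, Finset.smul_sum]
  simp only [derivation_gegenbauerTerm s p hν]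
  rw [Finset.sum_add_distrib]
  congr 1
  · refine Finset.sum_congr rfl fun j _ => ?_
    rw [show n - 1 - 2 * (j : ℤ) = n - 2 * j - 1 by ring]
  · rw [Finset.sum_range_succ']
    simp only [if_true, smul_zero, add_zero]
    refine Finset.sum_congr rfl fun j _ => ?_
    rw [if_neg (by lia), Nat.add_sub_cancel,
      show n - 2 - 2 * (j : ℤ) = n - 2 * (j + 1 : ℕ) by push_cast; ring]

/-- Euler's relation with `s` of weight one and `p` of weight two: on each term `n = (n - 2j) + 2j`.
-/
theorem gegenbauerForm_euler (hν : 0 < ν) (n : ℤ) :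
    (n : ℝ) • gegenbauerForm ν n s p = (2 * ν) • (s * gegenbauerForm (ν + 1) (n - 1) s p -
      p * gegenbauerForm (ν + 1) (n - 2) s p) := by
  have h0 : n < 2 * (n.toNat + 1 : ℕ) := by lia
  have h1 : n - 1 < 2 * (n.toNat + 1 : ℕ) := by lia
  have h2 : n - 2 < 2 * (n.toNat : ℕ) := by lia
  rw [gegenbauerForm_eq_sum _ _ _ h0, gegenbauerForm_eq_sum _ _ _ h1,
    gegenbauerForm_eq_sum _ _ _ h2, Finset.mul_sum, Finset.mul_sum, smul_sub,
    Finset.smul_sum, Finset.smul_sum, Finset.smul_sum]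
  have key : ∀ j : ℕ, (n : ℝ) • gegenbauerTerm ν s p (n - 2 * j) j =
      (2 * ν) • (s * gegenbauerTerm (ν + 1) s p (n - 1 - 2 * j) j) +
        (2 * j : ℝ) • gegenbauerTerm ν s p (n - 2 * j) j := fun j => by
    have h := smul_gegenbauerTerm_left s p hν (n - 2 * j) j
    rw [show n - 1 - 2 * (j : ℤ) = n - 2 * j - 1 by ring, ← h, ← add_smul]
    push_cast
    congr 1
    ring
  simp only [key]
  rw [Finset.sum_add_distrib, sub_eq_add_neg _ (Finset.sum _ _)]
  congr 1
  -- The factor `2j` kills the term `j = 0`; the term `j + 1` then matches term `j` of the sum of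
  -- index `n - 2`.
  rw [Finset.sum_range_succ', ← Finset.sum_neg_distrib]
  simp only [Nat.cast_zero, mul_zero, zero_smul, add_zero]
  refine Finset.sum_congr rfl fun j _ => ?_
  have h := smul_gegenbauerTerm_right s p hν (n - 2 * (j + 1 : ℕ)) j
  push_cast at h ⊢
  rw [mul_smul, h, smul_smul, ← neg_smul, show n - 2 - 2 * (j : ℤ) = n - 2 * (j + 1) by ring]
  congr 1
  ring

/-- In generating functions, `(1 - 2sz + pz²)^{-ν}` is `1 - 2sz + pz²` times `(1 - 2sz +
pz²)^{-ν-1}`. The proof is termwise, writing `ν = (i + j + ν) - i - j` for the term of degree `i` in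
`s` and `j` in `p`. -/
theorem gegenbauerForm_eq_add_one (hν : 0 < ν) (n : ℤ) :
    gegenbauerForm ν n s p = gegenbauerForm (ν + 1) n s p -
      2 * s * gegenbauerForm (ν + 1) (n - 1) s p + p * gegenbauerForm (ν + 1) (n - 2) s p := by
  have h0 : n < 2 * (n.toNat + 1 : ℕ) := by lia
  have h1 : n - 1 < 2 * (n.toNat + 1 : ℕ) := by lia
  have h2 : n - 2 < 2 * (n.toNat : ℕ) := by lia
  have key : ∀ j : ℕ, ν • gegenbauerTerm ν s p (n - 2 * j) j =
      ν • gegenbauerTerm (ν + 1) s p (n - 2 * j) j -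
      ν • (2 * (s * gegenbauerTerm (ν + 1) s p (n - 1 - 2 * j) j)) -
        (j : ℝ) • gegenbauerTerm ν s p (n - 2 * j) j := fun j => by
    have h := smul_gegenbauerTerm_left s p hν (n - 2 * j) j
    have h' := smul_gegenbauerTerm_add_one s p hν (n - 2 * j) j
    rw [two_mul (s * _), ← two_smul ℝ (s * _), smul_smul, mul_comm ν 2,
      show n - 1 - 2 * (j : ℤ) = n - 2 * j - 1 by ring, ← h, h']
    module
  have key2 : ν • gegenbauerForm ν n s p = ν • (gegenbauerForm (ν + 1) n s p -
      2 * s * gegenbauerForm (ν + 1) (n - 1) s p + p * gegenbauerForm (ν + 1) (n - 2) s p) := by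
    rw [gegenbauerForm_eq_sum ν _ _ h0, gegenbauerForm_eq_sum (ν + 1) _ _ h0,
      gegenbauerForm_eq_sum _ _ _ h1, gegenbauerForm_eq_sum _ _ _ h2, Finset.smul_sum]
    simp only [key]
    rw [Finset.sum_sub_distrib, Finset.sum_sub_distrib, smul_add, smul_sub, sub_eq_add_neg,
      ← Finset.smul_sum, ← Finset.smul_sum, ← Finset.mul_sum, ← Finset.mul_sum, ← mul_assoc]
    congr 1
    rw [Finset.sum_range_succ', Nat.cast_zero, zero_smul, add_zero, ← Finset.sum_neg_distrib,
      Finset.mul_sum, Finset.smul_sum]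
    refine Finset.sum_congr rfl fun j _ => ?_
    have h := smul_gegenbauerTerm_right s p hν (n - 2 * (j + 1 : ℕ)) j
    push_cast at h ⊢
    rw [h, neg_smul, neg_neg, show n - 2 - 2 * (j : ℤ) = n - 2 * (j + 1) by ring]
  have := congrArg (ν⁻¹ • ·) key2
  simpa [smul_smul, hν.ne'] using this

/-- Euler's relation plus `ν` times the parameter shift: the terms containing `s` cancel. -/
theorem smul_gegenbauerForm_eq_sub (hν : 0 < ν) (n : ℤ) :
    (n + ν) • gegenbauerForm ν n s p = ν • (gegenbauerForm (ν + 1) n s p -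
      p * gegenbauerForm (ν + 1) (n - 2) s p) := by
  have h1 := gegenbauerForm_euler s p hν n
  have h2 := gegenbauerForm_eq_add_one s p hν n
  rw [add_smul, h1]
  nth_rewrite 1 [h2]
  rw [two_mul s, add_mul]
  module

end GegenbauerForm

theorem norm_pow_mul_gegenbauer {m : ℕ} (k : ℕ) (ν : ℝ) (x y : E m) :
    ‖x‖ ^ k * ‖y‖ ^ k * gegenbauer k ν (angle x y) =
      gegenbauerForm ν k (inner ℝ x y) (‖x‖ ^ 2 * ‖y‖ ^ 2) := by
  -- Division by zero is harmless: if `x` or `y` is zero, both sides vanish.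
  have hs : ‖x‖ * ‖y‖ * angle x y = inner ℝ x y := by
    unfold angle
    rcases eq_or_ne x 0 with rfl | hx
    · simp
    rcases eq_or_ne y 0 with rfl | hy
    · simp
    have := norm_ne_zero_iff.2 hx
    have := norm_ne_zero_iff.2 hy
    field_simp
  rw [gegenbauerForm_eq_sum (N := k / 2 + 1) _ _ _ (by lia), gegenbauer, Finset.mul_sum]
  refine Finset.sum_congr rfl fun j hj => ?_
  have hjk : 2 * j ≤ k := by simp at hj; lia
  obtain ⟨i, rfl⟩ := Nat.exists_eq_add_of_le hjk
  have e1 : ((2 * j + i : ℕ) : ℤ) - 2 * j = i := by push_cast; ring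
  have e2 : ((2 * j + i : ℕ) : ℝ) - j = i + j := by push_cast; ring
  rw [e1, gegenbauerTerm_natCast, ← hs, Nat.add_sub_cancel_left, e2, gegenbauerCoeff, smul_eq_mul]
  rw [mul_pow 2 (angle x y)]
  ring

/-! ### Means of polynomials over the sphere -/

section SphereMean

open MvPolynomial Set Measure

variable {m : ℕ}

theorem eval_smul_of_isHomogeneous {σ : Type*} {q : MvPolynomial σ ℝ} {d : ℕ}
    (hq : q.IsHomogeneous d) (r : ℝ) (x : σ → ℝ) : eval (r • x) q = r ^ d * eval x q := by
  rw [eval_eq, eval_eq, Finset.mul_sum]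
  refine Finset.sum_congr rfl fun α hα => ?_
  have h : α.degree = d := by
    rw [Finsupp.degree_eq_weight_one]
    exact hq (mem_support_iff.1 hα)
  simp only [Pi.smul_apply, smul_eq_mul, mul_pow, Finset.prod_mul_distrib]
  rw [Finset.prod_pow_eq_pow_sum, ← Finsupp.degree_apply, h]
  ring

theorem continuous_eval_ofLp (q : MvPolynomial (Fin m) ℝ) :
    Continuous fun x : E m => eval x.ofLp q :=
  (MvPolynomial.continuous_eval q).comp (PiLp.continuous_ofLp 2 _)

/-- The mean of a polynomial over the unit sphere. -/
def sphereMean (q : MvPolynomial (Fin m) ℝ) : ℝ :=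
  (sphereArea m)⁻¹ * ∫ x : Metric.sphere (0 : E m) 1, eval x.1.ofLp q ∂(volume : Measure (E m)).toSphere

theorem integrable_sphere {V : Type*} [NormedAddCommGroup V] {f : E m → V} (hf : Continuous f) :
    Integrable (fun x : Metric.sphere (0 : E m) 1 => f x) (volume : Measure (E m)).toSphere :=
  (hf.comp continuous_subtype_val).integrable_of_hasCompactSupport
    (HasCompactSupport.of_compactSpace _)

theorem sphereMean_add (q q' : MvPolynomial (Fin m) ℝ) :
    sphereMean (q + q') = sphereMean q + sphereMean q' := by
  simp only [sphereMean, map_add]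
  rw [integral_add (integrable_sphere (continuous_eval_ofLp q))
    (integrable_sphere (continuous_eval_ofLp q')), mul_add]

theorem sphereMean_smul (c : ℝ) (q : MvPolynomial (Fin m) ℝ) :
    sphereMean (c • q) = c * sphereMean q := by
  simp only [sphereMean, smul_eval]
  rw [integral_const_mul]
  ring

/-- `sphereMean` as a linear functional. -/
def sphereMeanLin : MvPolynomial (Fin m) ℝ →ₗ[ℝ] ℝ where
  toFun := sphereMean
  map_add' := sphereMean_add
  map_smul' := sphereMean_smul

theorem sphereMean_sum {ι : Type*} (s : Finset ι) (q : ι → MvPolynomial (Fin m) ℝ) :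
    sphereMean (∑ i ∈ s, q i) = ∑ i ∈ s, sphereMean (q i) :=
  map_sum (sphereMeanLin (m := m)) q s

theorem sphereMean_sub (q q' : MvPolynomial (Fin m) ℝ) :
    sphereMean (q - q') = sphereMean q - sphereMean q' :=
  map_sub (sphereMeanLin (m := m)) q q'

theorem sphereMean_zero : sphereMean (0 : MvPolynomial (Fin m) ℝ) = 0 :=
  map_zero (sphereMeanLin (m := m))

theorem sphereArea_pos [NeZero m] : 0 < sphereArea m := by
  have : 0 < m := Nat.pos_of_neZero m
  unfold sphereArea
  have := Real.Gamma_pos_of_pos (show (0 : ℝ) < m / 2 by positivity)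
  positivity

/-- The surface measure has total mass `m` times the volume of the ball, and `Γ(m/2 + 1) = (m/2)
Γ(m/2)`. -/
theorem toSphere_real_univ [NeZero m] :
    (volume : Measure (E m)).toSphere.real univ = sphereArea m := by
  have hm : (0 : ℝ) < m := by exact_mod_cast Nat.pos_of_neZero m
  have := Real.Gamma_pos_of_pos (show (0 : ℝ) < m / 2 by positivity)
  rw [toSphere_real_apply_univ, Measure.real, EuclideanSpace.volume_ball, finrank_euclideanSpace,
    Fintype.card_fin, ENNReal.ofReal_one, one_pow, one_mul, ENNReal.toReal_ofReal (by
      rw [Real.Gamma_add_one (by positivity)]; positivity), Real.Gamma_add_one (by positivity),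
      sphereArea, Real.sqrt_eq_rpow, ← Real.rpow_mul_natCast Real.pi_pos.le]
  field_simp

theorem sphereMean_one [NeZero m] : sphereMean (1 : MvPolynomial (Fin m) ℝ) = 1 := by
  simp only [sphereMean, map_one, integral_const, toSphere_real_univ, smul_eq_mul, mul_one]
  exact inv_mul_cancel₀ sphereArea_pos.ne'

theorem eval_sum_sq (x : E m) : eval x.ofLp (∑ i : Fin m, X i ^ 2) = ‖x‖ ^ 2 := by
  simp [EuclideanSpace.norm_sq_eq]

theorem sphereMean_normSq_mul (q : MvPolynomial (Fin m) ℝ) :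
    sphereMean ((∑ i, X i ^ 2) * q) = sphereMean q := by
  unfold sphereMean
  congr 2
  funext x
  rw [map_mul, eval_sum_sq, norm_eq_of_mem_sphere]
  simp

theorem hasLineDerivAt_eval (q : MvPolynomial (Fin m) ℝ) (x : E m) (j : Fin m) :
    HasLineDerivAt ℝ (fun x : E m => eval x.ofLp q) (eval x.ofLp (pderiv j q)) x
      (EuclideanSpace.single j 1) := by
  unfold HasLineDerivAt
  induction q using MvPolynomial.induction_on with
  | C a => simpa using hasDerivAt_const (0 : ℝ) a
  | add p q hp hq => simpa using hp.fun_add hq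
  | mul_X p i hp =>
    have h : HasDerivAt (fun t : ℝ => x i + t * (if i = j then 1 else 0)) (if i = j then 1 else 0)
        0 := by
      simpa using ((hasDerivAt_id (0 : ℝ)).mul_const (if i = j then (1 : ℝ) else 0)).const_add (x i)
    refine ((hp.fun_mul h).congr_deriv ?_).congr_of_eventuallyEq (.of_forall fun t => ?_)
    · by_cases hij : i = j
      · subst hij; simp; ring
      · simp [hij, pderiv_X]; ring
    · simp [Pi.single_apply]

/-! ### Gaussian integrals in polar coordinates and integration by parts -/

section Gaussian

/-- The radial Gaussian moment. -/
def gaussianMoment (m d : ℕ) : ℝ :=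
  ∫ r : Ioi (0 : ℝ), (r : ℝ) ^ d * Real.exp (-(r : ℝ) ^ 2) ∂(volumeIoiPow (m - 1))

theorem integrable_gaussianMoment [NeZero m] (d : ℕ) :
    Integrable (fun r : Ioi (0 : ℝ) => (r : ℝ) ^ d * Real.exp (-(r : ℝ) ^ 2))
      (volumeIoiPow (m - 1)) := by
  have h : IntegrableOn (fun r : ℝ => r ^ (m - 1) * (r ^ d * Real.exp (-r ^ 2))) (Ioi 0) := by
    refine (integrableOn_rpow_mul_exp_neg_rpow (p := 2) (s := ((m - 1 + d : ℕ) : ℝ))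
      (by linarith [Nat.cast_nonneg (α := ℝ) (m - 1 + d)]) two_pos).congr_fun (fun r hr => ?_)
      measurableSet_Ioi
    simp only [Real.rpow_natCast, Real.rpow_two, pow_add, mul_assoc]
  rw [integrableOn_iff_comap_subtypeVal measurableSet_Ioi] at h
  rw [volumeIoiPow, integrable_withDensity_iff_integrable_smul' (by fun_prop) (by simp)]
  refine h.congr (.of_forall fun r => ?_)
  have hr : (0 : ℝ) ≤ (r : ℝ) ^ (m - 1) := pow_nonneg (le_of_lt r.2) _
  simp [ENNReal.toReal_ofReal hr]

theorem gaussianMoment_eq [NeZero m] (d : ℕ) :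
    gaussianMoment m d = Real.Gamma ((d + m) / 2) / 2 := by
  have h : gaussianMoment m d =
      ∫ r in Ioi (0 : ℝ), r ^ (((m - 1 + d : ℕ) : ℝ)) * Real.exp (-r ^ (2 : ℝ)) := by
    rw [gaussianMoment, volumeIoiPow]
    simp only [ENNReal.ofReal]
    rw [integral_withDensity_eq_integral_smul (by fun_prop), integral_subtype_comap
      measurableSet_Ioi fun r : ℝ ↦ Real.toNNReal (r ^ (m - 1)) •
        (r ^ d * Real.exp (-r ^ 2))]
    refine setIntegral_congr_fun measurableSet_Ioi fun r hr => ?_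
    have hr : (0 : ℝ) ≤ r ^ (m - 1) := pow_nonneg (le_of_lt hr) _
    simp only [Real.rpow_natCast, Real.rpow_two, pow_add, mul_assoc, NNReal.smul_def,
      Real.coe_toNNReal _ hr, smul_eq_mul]
  rw [h, integral_rpow_mul_exp_neg_rpow two_pos
    (by linarith [Nat.cast_nonneg (α := ℝ) (m - 1 + d)])]
  have hm : m - 1 + d + 1 = d + m := by have := Nat.pos_of_neZero m; lia
  have : ((m - 1 + d : ℕ) : ℝ) + 1 = d + m := by exact_mod_cast hm
  rw [this]
  ring

theorem measurePreserving_polar : MeasurePreserving (homeomorphUnitSphereProd (E m))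
    ((volume : Measure (E m)).comap (↑))
      ((volume : Measure (E m)).toSphere.prod (volumeIoiPow (m - 1))) := by
  have := (volume : Measure (E m)).measurePreserving_homeomorphUnitSphereProd
  rwa [finrank_euclideanSpace, Fintype.card_fin] at this

/-- Homogeneity separates the integrand into a spherical and a radial factor, so that Fubini turns
the Gaussian integral into a sphere mean times a moment. -/
theorem eval_mul_exp_polar {q : MvPolynomial (Fin m) ℝ} {d : ℕ} (hq : q.IsHomogeneous d)
    (x : ({0}ᶜ : Set (E m))) :
    eval x.1.ofLp q * Real.exp (-‖x.1‖ ^ 2) =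
      eval (homeomorphUnitSphereProd (E m) x).1.1.ofLp q *
        (((homeomorphUnitSphereProd (E m) x).2.1) ^ d *
          Real.exp (-((homeomorphUnitSphereProd (E m) x).2.1) ^ 2)) := by
  have h : x.1.ofLp = ‖x.1‖ • (homeomorphUnitSphereProd (E m) x).1.1.ofLp := by
    have hx : ‖x.1‖ ≠ 0 := norm_ne_zero_iff.2 x.2
    simp [smul_smul, hx]
  rw [h, eval_smul_of_isHomogeneous hq]
  simp
  ring

theorem integrable_eval_mul_exp [NeZero m] {q : MvPolynomial (Fin m) ℝ} {d : ℕ} (hq : q.IsHomogeneous d) :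
    Integrable (fun x : E m => eval x.ofLp q * Real.exp (-‖x‖ ^ 2)) := by
  have h1 : Integrable (fun z : Metric.sphere (0 : E m) 1 × Ioi (0 : ℝ) =>
      eval z.1.1.ofLp q * ((z.2 : ℝ) ^ d * Real.exp (-(z.2 : ℝ) ^ 2)))
      ((volume : Measure (E m)).toSphere.prod (volumeIoiPow (m - 1))) :=
    (integrable_sphere (continuous_eval_ofLp q)).mul_prod (integrable_gaussianMoment d)
  have h2 := (measurePreserving_polar.integrable_comp_emb
    (Homeomorph.measurableEmbedding _)).2 h1
  rw [← restrict_compl_singleton (μ := (volume : Measure (E m))) 0, ← IntegrableOn,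
    integrableOn_iff_comap_subtypeVal (by measurability)]
  refine h2.congr (.of_forall fun x => ?_)
  exact (eval_mul_exp_polar hq x).symm

theorem integral_eval_mul_exp [NeZero m] {q : MvPolynomial (Fin m) ℝ} {d : ℕ} (hq : q.IsHomogeneous d) :
    ∫ x : E m, eval x.ofLp q * Real.exp (-‖x‖ ^ 2) =
      sphereArea m * sphereMean q * gaussianMoment m d := by
  calc
    _ = ∫ x : ({(0)}ᶜ : Set (E m)), eval x.1.ofLp q * Real.exp (-‖x.1‖ ^ 2)
        ∂((volume : Measure (E m)).comap (↑)) := by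
      rw [integral_subtype_comap (measurableSet_singleton _).compl
        fun x : E m ↦ eval x.ofLp q * Real.exp (-‖x‖ ^ 2), restrict_compl_singleton]
    _ = ∫ z, eval z.1.1.ofLp q * ((z.2 : ℝ) ^ d * Real.exp (-(z.2 : ℝ) ^ 2))
        ∂((volume : Measure (E m)).toSphere.prod (volumeIoiPow (m - 1))) := by
      rw [← measurePreserving_polar.integral_comp (Homeomorph.measurableEmbedding _)]
      exact integral_congr_ae (.of_forall fun x => eval_mul_exp_polar hq x)
    _ = _ := by
      rw [integral_prod_mul (fun z : Metric.sphere (0 : E m) 1 => eval z.1.ofLp q)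
        (fun r : Ioi (0 : ℝ) => (r : ℝ) ^ d * Real.exp (-(r : ℝ) ^ 2)), sphereMean,
        mul_inv_cancel_left₀ sphereArea_pos.ne', gaussianMoment]

theorem hasLineDerivAt_exp_neg_norm_sq (x : E m) (j : Fin m) :
    HasLineDerivAt ℝ (fun x : E m => Real.exp (-‖x‖ ^ 2)) (-2 * x j * Real.exp (-‖x‖ ^ 2)) x
      (EuclideanSpace.single j 1) := by
  have h := hasLineDerivAt_eval (∑ i : Fin m, X i ^ 2) x j
  simp only [eval_sum_sq] at h
  unfold HasLineDerivAt at h ⊢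
  refine h.fun_neg.exp.congr_deriv ?_
  simp [Derivation.leibniz_pow, pderiv_X, Pi.single_apply]
  ring

/-- Integration by parts over the whole space, since `∂_j e^{-|x|²} = -2 x_j e^{-|x|²}`. -/
theorem integral_X_mul_eval_mul_exp [NeZero m] {q : MvPolynomial (Fin m) ℝ} {d : ℕ}
    (hq : q.IsHomogeneous d) (j : Fin m) :
    2 * ∫ x : E m, eval x.ofLp (X j * q) * Real.exp (-‖x‖ ^ 2) =
      ∫ x : E m, eval x.ofLp (pderiv j q) * Real.exp (-‖x‖ ^ 2) := by
  have hX := (isHomogeneous_X ℝ j).mul hq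
  have key := integral_bilinear_hasLineDerivAt_right_eq_neg_left_of_integrable
    (μ := (volume : Measure (E m))) (B := ContinuousLinearMap.mul ℝ ℝ)
    (f := fun x : E m => eval x.ofLp q) (f' := fun x => eval x.ofLp (pderiv j q))
    (g := fun x : E m => Real.exp (-‖x‖ ^ 2)) (g' := fun x => -2 * x j * Real.exp (-‖x‖ ^ 2))
    (v := EuclideanSpace.single j 1) (integrable_eval_mul_exp hq.pderiv)
    (((integrable_eval_mul_exp hX).const_mul (-2)).congr (.of_forall fun x => by simp; ring))
    (integrable_eval_mul_exp hq) (fun x _ => hasLineDerivAt_eval q x j)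
    (fun x _ => hasLineDerivAt_exp_neg_norm_sq x j)
  change ∫ x : E m, eval x.ofLp q * (-2 * x j * Real.exp (-‖x‖ ^ 2)) =
    -∫ x : E m, eval x.ofLp (pderiv j q) * Real.exp (-‖x‖ ^ 2) at key
  have e : ∫ x : E m, eval x.ofLp q * (-2 * x j * Real.exp (-‖x‖ ^ 2)) =
      -2 * ∫ x : E m, eval x.ofLp (X j * q) * Real.exp (-‖x‖ ^ 2) := by
    rw [← integral_const_mul]
    congr 1; funext x; simp; ring
  linarith

/-- Integration by parts on the sphere. -/
theorem sphereMean_X_mul [NeZero m] {q : MvPolynomial (Fin m) ℝ} {d : ℕ}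
    (hq : q.IsHomogeneous d) (j : Fin m) :
    ((d : ℝ) - 1 + m) * sphereMean (X j * q) = sphereMean (pderiv j q) := by
  have key := integral_X_mul_eval_mul_exp hq j
  have hm : (0 : ℝ) < m := by exact_mod_cast Nat.pos_of_neZero m
  have hS := sphereArea_pos (m := m)
  rw [integral_eval_mul_exp ((isHomogeneous_X ℝ j).mul hq), integral_eval_mul_exp hq.pderiv,
    gaussianMoment_eq, gaussianMoment_eq] at key
  -- Degree zero is separate because the degree `d - 1` of the derivative is truncated; there both
  -- sides vanish.
  rcases d with _ | d
  · obtain ⟨c, rfl⟩ : ∃ c, q = C c := ⟨_, totalDegree_eq_zero_iff_eq_C.1 (by simpa using hq.totalDegree_le)⟩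
    have hG := Real.Gamma_pos_of_pos (show (0 : ℝ) < (1 + m) / 2 by positivity)
    simp [sphereMean_zero, hS.ne', hG.ne'] at key ⊢
    simp [key]
  have hG := Real.Gamma_pos_of_pos (show (0 : ℝ) < (d + m) / 2 by positivity)
  -- The two radial moments differ by `Γ(z+1) = zΓ(z)` at `z = (d + m)/2`; this ratio is the
  -- constant in the claim.
  rw [show ((1 + (d + 1) : ℕ) : ℝ) = d + 2 by push_cast; ring, Nat.add_sub_cancel,
    show ((d : ℝ) + 2 + m) / 2 = (d + m) / 2 + 1 by ring, Real.Gamma_add_one (by positivity)] at key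
  have : (sphereArea m * Real.Gamma ((d + m) / 2)) * (((d + 1 : ℕ) - 1 + m) * sphereMean (X j * q)) =
      (sphereArea m * Real.Gamma ((d + m) / 2)) * sphereMean (pderiv j q) := by
    push_cast
    linear_combination 2 * key
  exact mul_left_cancel₀ (by positivity) this

end Gaussian
end SphereMean

/-! ### Harmonic polynomials, zonal harmonics and the Funk–Hecke formula -/

section Harmonic

open MvPolynomial

variable {m : ℕ}

/-- The Laplace operator on polynomials. -/
def laplacian : MvPolynomial (Fin m) ℝ →ₗ[ℝ] MvPolynomial (Fin m) ℝ :=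
  ∑ i, (pderiv i).toLinearMap ∘ₗ (pderiv i).toLinearMap

theorem laplacian_apply (q : MvPolynomial (Fin m) ℝ) :
    laplacian q = ∑ i, pderiv i (pderiv i q) := by
  simp [laplacian]

theorem pderiv_comm (i j : Fin m) (q : MvPolynomial (Fin m) ℝ) :
    pderiv i (pderiv j q) = pderiv j (pderiv i q) := by
  let D : Fin m → Derivation ℝ (MvPolynomial (Fin m) ℝ) (MvPolynomial (Fin m) ℝ) := fun i => pderiv i
  have : ⁅D i, D j⁆ = 0 := by
    refine MvPolynomial.derivation_ext fun k => ?_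
    simp [D, Derivation.commutator_apply, pderiv_X, Pi.single_apply]
    split_ifs <;> simp
  have := congrArg (fun D => D q) this
  simpa [D, Derivation.commutator_apply, sub_eq_zero] using this

theorem laplacian_pderiv (i : Fin m) (q : MvPolynomial (Fin m) ℝ) :
    laplacian (pderiv i q) = pderiv i (laplacian q) := by
  simp only [laplacian_apply, map_sum]
  exact Finset.sum_congr rfl fun j _ => by rw [pderiv_comm j i, pderiv_comm j i]

theorem laplacian_X_mul (j : Fin m) (q : MvPolynomial (Fin m) ℝ) :
    laplacian (X j * q) = X j * laplacian q + 2 * pderiv j q := by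
  have h : ∀ i, pderiv i (pderiv i (X j * q)) =
      X j * pderiv i (pderiv i q) + if i = j then 2 * pderiv j q else 0 := fun i => by
    by_cases hij : i = j
    · subst hij
      simp [Derivation.leibniz]; ring
    · simp [Derivation.leibniz, hij, pderiv_X, Ne.symm hij]
  rw [laplacian_apply, laplacian_apply, Finset.sum_congr rfl fun i _ => h i,
    Finset.sum_add_distrib, Finset.mul_sum]
  simp

/-- Green's formula on the sphere. -/
theorem sphereMean_mul_of_laplacian_eq_zero [NeZero m] {f h : MvPolynomial (Fin m) ℝ} {a b : ℕ}
    (hf : f.IsHomogeneous a) (hh : h.IsHomogeneous b) (hΔ : laplacian h = 0) :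
    ((a : ℝ) + b + m - 2) * b * sphereMean (f * h) =
      sphereMean (∑ j, pderiv j f * pderiv j h) := by
  rcases b with _ | b
  · obtain ⟨c, rfl⟩ : ∃ c, h = C c :=
      ⟨_, totalDegree_eq_zero_iff_eq_C.1 (by simpa using hh.totalDegree_le)⟩
    simp [sphereMean_zero]
  -- Euler's formula writes `h` through `x_j ∂_j h`. Integrating each `x_j` by parts gives the
  -- divergence of `f ∇h`, which is `∇f · ∇h` as `h` is harmonic.
  have h1 : ((b + 1 : ℕ) : ℝ) * sphereMean (f * h) =
      ∑ j, sphereMean (X j * (f * pderiv j h)) := by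
    rw [← sphereMean_smul, ← sphereMean_sum, ← mul_smul_comm, Nat.cast_smul_eq_nsmul,
      ← hh.sum_X_mul_pderiv, Finset.mul_sum]
    congr 1
    exact Finset.sum_congr rfl fun j _ => by ring
  have h2 : ∀ j, ((a : ℝ) + (b + 1 : ℕ) + m - 2) * sphereMean (X j * (f * pderiv j h)) =
      sphereMean (pderiv j (f * pderiv j h)) := fun j => by
    rw [← sphereMean_X_mul (hf.mul hh.pderiv)]
    congr 1
    push_cast [Nat.add_sub_cancel]
    ring
  rw [mul_assoc, h1, Finset.mul_sum, Finset.sum_congr rfl fun j _ => h2 j, ← sphereMean_sum]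
  congr 1
  simp only [Derivation.leibniz, smul_eq_mul, Finset.sum_add_distrib]
  rw [← Finset.mul_sum, ← laplacian_apply, hΔ, mul_zero, zero_add]
  exact Finset.sum_congr rfl fun j _ => mul_comm _ _

/-- Harmonic polynomials of different degrees are orthogonal on the sphere. -/
theorem sphereMean_mul_eq_zero_of_ne (hm : 3 ≤ m) {f h : MvPolynomial (Fin m) ℝ} {a b : ℕ}
    (hf : f.IsHomogeneous a) (hh : h.IsHomogeneous b) (hΔf : laplacian f = 0)
    (hΔh : laplacian h = 0) (hab : a ≠ b) : sphereMean (f * h) = 0 := by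
  have : NeZero m := ⟨by lia⟩
  have h1 := sphereMean_mul_of_laplacian_eq_zero hf hh hΔh
  have h2 := sphereMean_mul_of_laplacian_eq_zero hh hf hΔf
  have h3 : ∑ j, pderiv j h * pderiv j f = ∑ j, pderiv j f * pderiv j h :=
    Finset.sum_congr rfl fun j _ => mul_comm _ _
  rw [h3, ← h1, mul_comm h f] at h2
  have hm' : (3 : ℝ) ≤ m := by exact_mod_cast hm
  -- Green's formula applied both ways has the same right-hand side; this is the difference.
  have h4 : ((a : ℝ) + b + m - 2) * (a - b) * sphereMean (f * h) = 0 := by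
    linear_combination h2
  have h5 : (a : ℝ) + b + m - 2 ≠ 0 := by
    have := Nat.cast_nonneg (α := ℝ) a
    have := Nat.cast_nonneg (α := ℝ) b
    linarith
  have h6 : (a : ℝ) - b ≠ 0 := sub_ne_zero.2 (by exact_mod_cast hab)
  simpa [h5, h6] using h4

theorem isHomogeneous_gegenbauerForm {s p : MvPolynomial (Fin m) ℝ} (hs : s.IsHomogeneous 1)
    (hp : p.IsHomogeneous 2) (ν : ℝ) (k : ℕ) :
    (gegenbauerForm ν k s p).IsHomogeneous k := by
  refine IsHomogeneous.sum _ _ _ fun j _ => ?_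
  unfold gegenbauerTerm
  split_ifs with hj
  · have := ((hs.pow ((k : ℤ) - 2 * j).toNat).mul (hp.pow j)).C_mul
      (gegenbauerCoeff ν ((k : ℤ) - 2 * j).toNat j)
    rw [smul_eq_C_mul]
    convert this using 1
    lia
  · exact isHomogeneous_zero _ _ _

/-- The linear form `x ↦ ⟨x, y⟩` as a polynomial. -/
def linearForm (y : E m) : MvPolynomial (Fin m) ℝ := ∑ i, y i • X i

/-- The quadratic form `x ↦ |x|² |y|²` as a polynomial. -/
def normForm (y : E m) : MvPolynomial (Fin m) ℝ := (‖y‖ ^ 2) • ∑ i, X i ^ 2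

/-- The polynomial `x ↦ |x|^n |y|^n C_n^ν(t)`. -/
def zonal (ν : ℝ) (n : ℤ) (y : E m) : MvPolynomial (Fin m) ℝ :=
  gegenbauerForm ν n (linearForm y) (normForm y)

theorem eval_linearForm (x y : E m) : eval x.ofLp (linearForm y) = inner ℝ x y := by
  simp [linearForm, PiLp.inner_apply, smul_eval]

theorem eval_normForm (x y : E m) : eval x.ofLp (normForm y) = ‖x‖ ^ 2 * ‖y‖ ^ 2 := by
  rw [normForm, smul_eval, eval_sum_sq, mul_comm]

theorem eval_zonal (ν : ℝ) (n : ℤ) (x y : E m) :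
    eval x.ofLp (zonal ν n y) = gegenbauerForm ν n (inner ℝ x y) (‖x‖ ^ 2 * ‖y‖ ^ 2) := by
  have h := map_gegenbauerForm (aeval (R := ℝ) x.ofLp) ν n (linearForm y) (normForm y)
  simp only [← coe_aeval_eq_eval] at *
  rw [zonal]
  refine h.trans ?_
  congr 1
  · exact eval_linearForm x y
  · exact eval_normForm x y

theorem isHomogeneous_zonal (ν : ℝ) (k : ℕ) (y : E m) : (zonal ν k y).IsHomogeneous k := by
  refine isHomogeneous_gegenbauerForm ?_ ?_ ν k
  · exact IsHomogeneous.sum _ _ _ fun i _ => by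
      rw [smul_eq_C_mul]; exact (isHomogeneous_X ℝ i).C_mul _
  · rw [normForm, smul_eq_C_mul]
    exact (IsHomogeneous.sum _ _ _ fun i _ => by simpa using (isHomogeneous_X ℝ i).pow 2).C_mul _

theorem zonal_of_neg (ν : ℝ) {n : ℤ} (hn : n < 0) (y : E m) : zonal ν n y = 0 :=
  gegenbauerForm_of_neg _ _ _ hn

theorem pderiv_linearForm (i : Fin m) (y : E m) : pderiv i (linearForm y) = C (y i) := by
  simp [linearForm, pderiv_X, Pi.single_apply, smul_eq_C_mul]

theorem pderiv_normForm (i : Fin m) (y : E m) :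
    pderiv i (normForm y) = (2 * ‖y‖ ^ 2) • X i := by
  simp [normForm, pderiv_X, Pi.single_apply, Derivation.map_smul, Derivation.leibniz_pow, two_mul,
    two_smul, add_smul]

theorem pderiv_zonal {ν : ℝ} (hν : 0 < ν) (n : ℤ) (i : Fin m) (y : E m) :
    pderiv i (zonal ν n y) = (2 * ν) • (y i • zonal (ν + 1) (n - 1) y -
      (‖y‖ ^ 2) • (X i * zonal (ν + 1) (n - 2) y)) := by
  rw [zonal, derivation_gegenbauerForm _ _ hν, pderiv_linearForm, pderiv_normForm, ← zonal,
    ← zonal, mul_comm _ (C _), ← smul_eq_C_mul, mul_smul_comm, mul_comm _ (X i)]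
  module

theorem sum_mul_X (y : E m) : ∑ i, y i • (X i : MvPolynomial (Fin m) ℝ) = linearForm y := rfl

/-- Two differentiations leave a multiple of the parameter-shift identity at `μ + 1`. The choice of
`μ` matters: `2(μ + 1)` from the second derivative equals the trace `m` from `Σ ∂_i x_i`. -/
theorem laplacian_zonal (hm : 3 ≤ m) (n : ℤ) (y : E m) : laplacian (zonal (mu m) n y) = 0 := by
  have hm' : (3 : ℝ) ≤ m := by exact_mod_cast hm
  have h0 : 0 < mu m := by unfold mu; linarith
  have h1 : 0 < mu m + 1 := by linarith
  have hmu : 2 * (mu m + 1) = m := by unfold mu; ring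
  set F := fun n : ℤ => zonal (mu m + 1 + 1) n y
  have key : ∀ i, pderiv i (pderiv i (zonal (mu m) n y)) = (2 * mu m) •
      ((m : ℝ) • ((y i ^ 2) • F (n - 2) - (2 * ‖y‖ ^ 2) • ((y i • X i) * F (n - 3)) +
        (‖y‖ ^ 4) • (X i ^ 2 * F (n - 4))) - (‖y‖ ^ 2) • zonal (mu m + 1) (n - 2) y) := fun i => by
    rw [pderiv_zonal h0, Derivation.map_smul, map_sub, Derivation.map_smul, Derivation.map_smul,
      Derivation.leibniz, pderiv_zonal h1, pderiv_zonal h1, hmu, pderiv_X_self,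
      show n - 1 - 1 = n - 2 by ring, show n - 1 - 2 = n - 3 by ring,
      show n - 2 - 1 = n - 3 by ring, show n - 2 - 2 = n - 4 by ring]
    simp only [F, smul_eq_C_mul, smul_eq_mul, map_mul, map_pow]
    simp only [map_ofNat]
    ring
  have hy : ∑ i, y i ^ 2 = ‖y‖ ^ 2 := by simp [EuclideanSpace.norm_sq_eq]
  have hA := gegenbauerForm_eq_add_one (linearForm y) (normForm y) h1 (n - 2)
  rw [show n - 2 - 1 = n - 3 by ring, show n - 2 - 2 = n - 4 by ring] at hA
  rw [laplacian_apply, Finset.sum_congr rfl fun i _ => key i, ← Finset.smul_sum,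
    Finset.sum_sub_distrib, ← Finset.smul_sum, Finset.sum_add_distrib, Finset.sum_sub_distrib,
    ← Finset.sum_smul, hy, ← Finset.smul_sum, ← Finset.smul_sum, ← Finset.sum_mul,
    ← Finset.sum_mul, sum_mul_X, Finset.sum_const, Finset.card_univ, Fintype.card_fin,
    zonal, hA, ← zonal, ← zonal, ← zonal, ← Nat.cast_smul_eq_nsmul ℝ, normForm]
  simp only [F, smul_eq_C_mul, map_mul, map_pow]
  simp only [map_ofNat]
  ring

/-- On the sphere `|x|²|y|²` becomes the constant `|y|²`, so `smul_gegenbauerForm_eq_sub` becomes a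
recursion in steps of two for the means with parameter `μ + 1`. -/
theorem sphereMean_zonal_recurrence (hm : 3 ≤ m) (n : ℤ) (y : E m) (H : MvPolynomial (Fin m) ℝ) :
    mu m * sphereMean (zonal (mu m + 1) n y * H) = (n + mu m) * sphereMean (zonal (mu m) n y * H) +
      mu m * (‖y‖ ^ 2 * sphereMean (zonal (mu m + 1) (n - 2) y * H)) := by
  have hm' : (3 : ℝ) ≤ m := by exact_mod_cast hm
  have h0 : 0 < mu m := by unfold mu; linarith
  have h := smul_gegenbauerForm_eq_sub (linearForm y) (normForm y) h0 n
  rw [← zonal, ← zonal, ← zonal] at h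
  have h2 := congrArg (fun q => sphereMean (q * H)) h
  simp only [smul_mul_assoc, sphereMean_smul, sub_mul, sphereMean_sub] at h2
  have h3 : normForm y * zonal (mu m + 1) (n - 2) y * H =
      ‖y‖ ^ 2 • ((∑ i, X i ^ 2) * (zonal (mu m + 1) (n - 2) y * H)) := by
    rw [normForm, smul_mul_assoc, smul_mul_assoc, mul_assoc]
  rw [h3, sphereMean_smul, sphereMean_normSq_mul] at h2
  linear_combination -h2

/-- The recursion meets only zonal harmonics of degree below `l`, all orthogonal to `H`. The bound
`n` serves the strong induction on the integer index. -/
theorem sphereMean_zonal_of_lt (hm : 3 ≤ m) {H : MvPolynomial (Fin m) ℝ} {l : ℕ}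
    (hH : H.IsHomogeneous l) (hΔ : laplacian H = 0) (y : E m) (n : ℕ) :
    ∀ k : ℤ, k < n → k < l → sphereMean (zonal (mu m + 1) k y * H) = 0 := by
  have hm' : (3 : ℝ) ≤ m := by exact_mod_cast hm
  have h0 : mu m ≠ 0 := by unfold mu; linarith
  induction n with
  | zero => intro k hk _; rw [zonal_of_neg _ (by simpa using hk), zero_mul, sphereMean_zero]
  | succ n ih =>
    intro k hk hl
    rcases lt_or_ge k 0 with hk0 | hk0
    · rw [zonal_of_neg _ hk0, zero_mul, sphereMean_zero]
    have h := sphereMean_zonal_recurrence hm k y H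
    lift k to ℕ using hk0
    rw [ih (k - 2) (by lia) (by lia), sphereMean_mul_eq_zero_of_ne hm
      (isHomogeneous_zonal (mu m) k y) hH (laplacian_zonal hm k y) hΔ (by lia)] at h
    simpa [h0] using h

/-- The zonal harmonics reproduce harmonic polynomials of the same degree. -/
theorem sphereMean_zonal_mul (hm : 3 ≤ m) (y : E m) (k : ℕ) :
    ∀ {H : MvPolynomial (Fin m) ℝ}, H.IsHomogeneous k → laplacian H = 0 →
      (k + mu m) * sphereMean (zonal (mu m) k y * H) = mu m * eval y.ofLp H := by
  have : NeZero m := ⟨by lia⟩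
  have hm' : (3 : ℝ) ≤ m := by exact_mod_cast hm
  have h0 : 0 < mu m := by unfold mu; linarith
  have hmu : (m : ℝ) = 2 * mu m + 2 := by unfold mu; ring
  induction k with
  | zero =>
    intro H hH _
    obtain ⟨c, rfl⟩ : ∃ c, H = C c :=
      ⟨_, totalDegree_eq_zero_iff_eq_C.1 (by simpa using hH.totalDegree_le)⟩
    have : zonal (mu m) ((0 : ℕ) : ℤ) y = 1 := gegenbauerForm_zero h0 _ _
    rw [this, one_mul, ← mul_one (C c), ← smul_eq_C_mul, sphereMean_smul, sphereMean_one]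
    simp [smul_eval]
  | succ k ih =>
    intro H hH hΔ
    have h1 := sphereMean_mul_of_laplacian_eq_zero (isHomogeneous_zonal (mu m) (k + 1) y) hH hΔ
    -- Green's formula reduces `H` to its derivative in direction `y`, again harmonic and of degree
    -- one less; by Euler its value at `y` is `(k + 1) H(y)`.
    set G := ∑ j, y j • pderiv j H with hG
    have hGh : G.IsHomogeneous k := IsHomogeneous.sum _ _ _ fun j _ => by
      rw [smul_eq_C_mul]; exact hH.pderiv.C_mul _
    have hGΔ : laplacian G = 0 := by
      simp [hG, laplacian_pderiv, hΔ]
    have hGy : eval y.ofLp G = (k + 1) * eval y.ofLp H := by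
      have := congrArg (eval y.ofLp) hH.sum_X_mul_pderiv
      simpa [hG, smul_eval] using this
    have h2 : ∑ j, pderiv j (zonal (mu m) ((k + 1 : ℕ) : ℤ) y) * pderiv j H =
        (2 * mu m) • (zonal (mu m + 1) k y * G) -
          (2 * mu m * ‖y‖ ^ 2 * (k + 1)) • (zonal (mu m + 1) (k - 1) y * H) := by
      have e1 : ((k + 1 : ℕ) : ℤ) - 1 = k := by push_cast; ring
      have e2 : ((k + 1 : ℕ) : ℤ) - 2 = k - 1 := by push_cast; ring
      have e3 : ((k : ℝ) + 1) • H = ∑ j, X j * pderiv j H := by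
        rw [hH.sum_X_mul_pderiv, ← Nat.cast_smul_eq_nsmul ℝ]; push_cast; rfl
      rw [mul_smul _ ((k : ℝ) + 1), ← mul_smul_comm ((k : ℝ) + 1), e3, hG, Finset.mul_sum, Finset.mul_sum, Finset.smul_sum,
        Finset.smul_sum, ← Finset.sum_sub_distrib]
      refine Finset.sum_congr rfl fun j _ => ?_
      rw [pderiv_zonal h0, e1, e2]
      simp only [smul_eq_C_mul, map_mul]
      ring
    -- The radial part of the gradient has index `k - 1`, below the degree of `H`, and averages to
    -- zero.
    rw [h2, sphereMean_sub, sphereMean_smul, sphereMean_smul,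
      sphereMean_zonal_of_lt hm hH hΔ y (k + 1) (k - 1) (by lia) (by lia)] at h1
    have h3 := sphereMean_zonal_recurrence hm k y G
    rw [sphereMean_zonal_of_lt hm hGh hGΔ y (k + 1) (k - 2) (by lia) (by lia)] at h3
    have h4 := ih hGh hGΔ
    simp only [Int.cast_natCast] at h3
    have hk : (k : ℝ) + 1 ≠ 0 := by positivity
    have : (2 * (k + 1 : ℝ)) * ((k + 1 + mu m) * sphereMean (zonal (mu m) ((k + 1 : ℕ) : ℤ) y * H)) =
        (2 * (k + 1)) * (mu m * eval y.ofLp H) := by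
      push_cast at h1 ⊢
      rw [hmu] at h1
      linear_combination h1 + 2 * h3 + 2 * h4 + 2 * mu m * hGy
    have := mul_left_cancel₀ (by positivity) this
    push_cast at this ⊢
    exact this

/-- `r ^ (j / 2)` for even `j ≥ 0`, and zero for other `j`. -/
def evenPow (r : ℝ) (j : ℤ) : ℝ := if 0 ≤ j ∧ Even j then r ^ (j / 2).toNat else 0

/-- This has the shape of the recursion for zonal means, and its inhomogeneous term is what finally
becomes `δ_{kl}`. -/
theorem evenPow_eq (r : ℝ) (j : ℤ) :
    evenPow r j = (if j = 0 then 1 else 0) + r * evenPow r (j - 2) := by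
  unfold evenPow
  by_cases h : Even j
  · obtain ⟨i, rfl⟩ := h
    rcases lt_trichotomy i 0 with hi | rfl | hi
    · rw [if_neg (by lia), if_neg (by lia), if_neg (by lia)]; simp
    · simp
    · lift i to ℕ using hi.le
      obtain ⟨i, rfl⟩ : ∃ i', i = i' + 1 := ⟨i - 1, by lia⟩
      rw [if_pos ⟨by lia, ⟨_, rfl⟩⟩, if_neg (by lia),
        if_pos ⟨by lia, by rw [Int.even_sub]; simp⟩, zero_add, ← pow_succ']
      congr 1
      lia
  · have h2 : ¬ Even (j - 2) := by rw [Int.even_sub]; simpa using h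
    have : j ≠ 0 := by rintro rfl; simp at h
    simp [h, h2, this]

/-- The Funk–Hecke formula for the zonal polynomials with parameter `m / 2`. -/
theorem sphereMean_zonal_add_one_mul (hm : 3 ≤ m) {H : MvPolynomial (Fin m) ℝ} {l : ℕ}
    (hH : H.IsHomogeneous l) (hΔ : laplacian H = 0) (y : E m) (n : ℤ) :
    sphereMean (zonal (mu m + 1) n y * H) = evenPow (‖y‖ ^ 2) (n - l) * eval y.ofLp H := by
  have hm' : (3 : ℝ) ≤ m := by exact_mod_cast hm
  have h0 : mu m ≠ 0 := by unfold mu; linarith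
  suffices ∀ N : ℕ, ∀ n : ℤ, n < N → sphereMean (zonal (mu m + 1) n y * H) =
      evenPow (‖y‖ ^ 2) (n - l) * eval y.ofLp H from this (n.toNat + 1) n (by lia)
  intro N
  induction N with
  | zero =>
    intro n hn
    rw [zonal_of_neg _ (by simpa using hn), zero_mul, evenPow, if_neg (by lia), zero_mul]
    exact sphereMean_zero
  | succ N ih =>
    intro n hn
    rcases lt_or_ge n 0 with hn0 | hn0
    · rw [zonal_of_neg _ hn0, zero_mul, evenPow, if_neg (by lia), zero_mul]
      exact sphereMean_zero
    have h := sphereMean_zonal_recurrence hm n y H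
    lift n to ℕ using hn0
    rw [ih (n - 2) (by lia)] at h
    rw [evenPow_eq, show (n : ℤ) - l - 2 = n - 2 - l by ring]
    refine mul_left_cancel₀ h0 ?_
    rw [h]
    -- The inhomogeneous term: reproduction if the degrees agree, orthogonality otherwise.
    by_cases hnl : n = l
    · subst hnl
      rw [Int.cast_natCast, sphereMean_zonal_mul hm y n hH hΔ]
      simp
      ring
    · rw [sphereMean_mul_eq_zero_of_ne hm (isHomogeneous_zonal (mu m) n y) hH
        (laplacian_zonal hm n y) hΔ hnl, if_neg (by lia)]
      ring

end Harmonic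

/-! ### Products of Clifford vectors -/

section CliffordVectors

variable {m : ℕ}

theorem e_mul_self (j : Fin m) : (e j : Cl m) * e j = (-1 : ℝ) • 1 := by
  have h := e_mul_e_add (m := m) j j
  rw [if_pos rfl, ← two_smul ℝ] at h
  have h2 := congrArg ((2⁻¹ : ℝ) • ·) h
  simp only [smul_smul] at h2
  norm_num at h2
  rw [h2, show (2 : Cl m) = (2 : ℝ) • 1 by rw [two_smul, one_add_one_eq_two], smul_smul]
  norm_num

theorem e_mul_e_of_ne {j k : Fin m} (h : j ≠ k) : (e k : Cl m) * e j = -(e j * e k) := by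
  have := e_mul_e_add (m := m) j k
  rw [if_neg h] at this
  exact eq_neg_of_add_eq_zero_right this

theorem sum_sum_eq_sum_add_sum_Ioi {A : Type*} [AddCommMonoid A] (f : Fin m → Fin m → A) :
    ∑ j, ∑ k, f j k = ∑ j, f j j + ∑ j, ∑ k ∈ Finset.Ioi j, (f j k + f k j) := by
  have h1 : ∀ j k, f j k = (if k = j then f j j else 0) +
      ((if j < k then f j k else 0) + (if k < j then f j k else 0)) := fun j k => by
    rcases lt_trichotomy j k with h | h | h
    · simp [h, h.ne', h.not_gt]
    · simp [h]
    · simp [h, h.ne, h.not_gt]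
  have h2 : ∀ j : Fin m, Finset.Ioi j = Finset.univ.filter (j < ·) := fun j => by ext; simp
  rw [Finset.sum_congr rfl fun j _ => Finset.sum_congr rfl fun k _ => h1 j k]
  simp only [Finset.sum_add_distrib, h2, Finset.sum_filter, Finset.sum_ite_eq', Finset.mem_univ,
    if_true]
  rw [Finset.sum_comm (f := fun j k => if k < j then f j k else 0)]

theorem inner_eq_sum (x y : E m) : inner ℝ x y = ∑ j, x j * y j := by
  simp [PiLp.inner_apply, mul_comm]

theorem vec_mul_vec_eq_wedge (x y : E m) :
    vec x * vec y = (-inner ℝ x y) • (1 : Cl m) + wedge x y := by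
  simp only [vec, Finset.sum_mul_sum, smul_mul_smul_comm]
  rw [sum_sum_eq_sum_add_sum_Ioi]
  congr 1
  · simp only [e_mul_self, smul_smul]
    rw [← Finset.sum_smul, inner_eq_sum, ← Finset.sum_mul]
    simp
  · refine Finset.sum_congr rfl fun j _ => Finset.sum_congr rfl fun k hk => ?_
    rw [e_mul_e_of_ne (Finset.mem_Ioi.1 hk).ne]
    module

theorem vec_mul_vec_add (x y : E m) :
    vec x * vec y + vec y * vec x = (-2 * inner ℝ x y) • (1 : Cl m) := by
  have h : wedge y x = -wedge x y := by
    simp only [wedge, ← Finset.sum_neg_distrib]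
    refine Finset.sum_congr rfl fun j _ => Finset.sum_congr rfl fun k _ => ?_
    module
  rw [vec_mul_vec_eq_wedge, vec_mul_vec_eq_wedge, h, real_inner_comm]
  module

theorem vec_mul_vec_swap (x y : E m) :
    vec y * vec x = (-2 * inner ℝ x y) • (1 : Cl m) - vec x * vec y :=
  eq_sub_of_add_eq' (vec_mul_vec_add x y)

theorem vec_mul_self (x : E m) : vec x * vec x = (-‖x‖ ^ 2) • (1 : Cl m) := by
  have h := vec_mul_vec_add x x
  rw [← two_smul ℝ, real_inner_self_eq_norm_sq] at h
  have h2 := congrArg ((2⁻¹ : ℝ) • ·) h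
  simp only [smul_smul] at h2
  norm_num at h2
  rw [h2]
  module

theorem star_vec (x : E m) : star (vec x : Cl m) = -vec x := by
  simp [vec, star_sum, star_e]

end CliffordVectors

/-! ### The Dirac operator on zonal functions and the closed form of the kernel -/

section Dirac

open MvPolynomial

variable {m : ℕ}

theorem hasLineDerivAt_eval_smul (q : MvPolynomial (Fin m) ℝ) (c : Cl m) (x : E m) (j : Fin m) :
    HasLineDerivAt ℝ (fun x : E m => eval x.ofLp q • c) (eval x.ofLp (pderiv j q) • c) x
      (EuclideanSpace.single j 1) :=
  (hasLineDerivAt_eval q x j).smul_const c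

theorem vec_add_smul_single (x : E m) (j : Fin m) (t : ℝ) :
    vec (x + t • EuclideanSpace.single j 1) = vec x + t • (e j : Cl m) := by
  simp only [vec, PiLp.add_apply, PiLp.smul_apply, smul_eq_mul, add_smul, Finset.sum_add_distrib]
  congr 1
  rw [Finset.sum_eq_single j]
  · simp
  · intro i _ hi
    simp [hi]
  · simp

theorem hasLineDerivAt_eval_smul_vec_mul (q : MvPolynomial (Fin m) ℝ) (c : Cl m) (x : E m)
    (j : Fin m) :
    HasLineDerivAt ℝ (fun x : E m => eval x.ofLp q • (vec x * c))
      (eval x.ofLp (pderiv j q) • (vec x * c) + eval x.ofLp q • (e j * c)) x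
      (EuclideanSpace.single j 1) := by
  have h : HasLineDerivAt ℝ (fun x : E m => vec x * c) (e j * c) x
      (EuclideanSpace.single j 1) := by
    unfold HasLineDerivAt
    simp only [vec_add_smul_single, add_mul, smul_mul_assoc]
    simpa using ((hasDerivAt_id (0 : ℝ)).smul_const (e j * c)).const_add (vec x * c)
  have := HasDerivAt.fun_smul (hasLineDerivAt_eval q x j) h
  unfold HasLineDerivAt
  refine this.congr_deriv ?_
  simp only [zero_smul, add_zero]
  abel

/-- This symmetry lets the formulas for derivatives in `x` serve for derivatives in `y`. -/
theorem eval_zonal_comm (ν : ℝ) (n : ℤ) (x y : E m) :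
    eval x.ofLp (zonal ν n y) = eval y.ofLp (zonal ν n x) := by
  rw [eval_zonal, eval_zonal, real_inner_comm, mul_comm]

theorem sum_pderiv_zonal_smul_e {ν : ℝ} (hν : 0 < ν) (n : ℤ) (x y : E m) :
    ∑ j, eval x.ofLp (pderiv j (zonal ν n y)) • (e j : Cl m) =
      (2 * ν) • (eval x.ofLp (zonal (ν + 1) (n - 1) y) • vec y -
        (‖y‖ ^ 2 * eval x.ofLp (zonal (ν + 1) (n - 2) y)) • vec x) := by
  simp only [pderiv_zonal hν, vec, Finset.smul_sum]
  rw [← Finset.sum_sub_distrib, Finset.smul_sum]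
  refine Finset.sum_congr rfl fun j _ => ?_
  simp only [smul_eval, map_sub, map_mul, eval_X]
  module

theorem sum_e_mul_e : ∑ j, (e j : Cl m) * e j = (-m : ℝ) • (1 : Cl m) := by
  simp only [e_mul_self]
  rw [Finset.sum_const, Finset.card_univ, Fintype.card_fin, ← Nat.cast_smul_eq_nsmul ℝ, smul_smul]
  simp

theorem harmonicKernel_eq (k : ℕ) (x y : E m) :
    harmonicKernel k x y = ((k : ℝ) + mu m) / mu m * eval x.ofLp (zonal (mu m) k y) := by
  rw [harmonicKernel, eval_zonal, ← norm_pow_mul_gegenbauer]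
  ring

theorem mu_pos (hm : 3 ≤ m) : 0 < mu m := by
  have hm' : (3 : ℝ) ≤ m := by exact_mod_cast hm
  unfold mu; linarith

theorem two_mul_mu_add_one : 2 * (mu m + 1) = m := by unfold mu; ring

/-- The constant is `2(k + 1 + μ) = m + 2k`, one of the two factors that the normalization of the
kernel removes. -/
theorem diracLeft_harmonicKernel (hm : 3 ≤ m) (k : ℕ) (x y : E m) :
    diracLeft (fun x' : E m => algebraMap ℝ (Cl m) (harmonicKernel (k + 1) x' y)) x =
      ((m : ℝ) + 2 * k) • (eval x.ofLp (zonal (mu m + 1) k y) • vec y -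
        (‖y‖ ^ 2 * eval x.ofLp (zonal (mu m + 1) (k - 1) y)) • vec x) := by
  have h0 := mu_pos hm
  have hf : (fun x' : E m => algebraMap ℝ (Cl m) (harmonicKernel (k + 1) x' y)) =
      fun x' : E m => eval x'.ofLp (((((k + 1 : ℕ) : ℝ) + mu m) / mu m) •
        zonal (mu m) (k + 1 : ℕ) y) • (1 : Cl m) := by
    funext x'
    rw [harmonicKernel_eq, smul_eval, Algebra.algebraMap_eq_smul_one]
  rw [hf, diracLeft]
  simp only [partialDeriv, (hasLineDerivAt_eval_smul _ _ _ _).lineDeriv, mul_smul_comm, mul_one]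
  simp only [Derivation.map_smul, smul_eval, mul_smul]
  rw [← Finset.smul_sum, sum_pderiv_zonal_smul_e h0, smul_smul,
    show ((k + 1 : ℕ) : ℤ) - 1 = k by push_cast; ring,
    show ((k + 1 : ℕ) : ℤ) - 2 = k - 1 by push_cast; ring, mul_smul (‖y‖ ^ 2)]
  congr 1
  rw [← two_mul_mu_add_one (m := m)]
  push_cast
  field_simp
  ring

/-- The closed form of the monogenic kernel in terms of zonal polynomials. -/
theorem monogenicKernel_eq (hm : 3 ≤ m) (k : ℕ) (x y : E m) :
    monogenicKernel k x y = eval x.ofLp (zonal (mu m + 1) k y) • 1 +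
      eval x.ofLp (zonal (mu m + 1) (k - 1) y) • (vec x * vec y) := by
  have h0 := mu_pos hm
  have h1 : 0 < mu m + 1 := by linarith
  -- Now `x` is fixed and `y` varies; the factor `|y|²` must be differentiated too, so it is
  -- absorbed into `r`.
  set q : MvPolynomial (Fin m) ℝ := ((m : ℝ) + 2 * k) • zonal (mu m + 1) k x with hq
  set r : MvPolynomial (Fin m) ℝ :=
    ((m : ℝ) + 2 * k) • ((∑ i, X i ^ 2) * zonal (mu m + 1) (k - 1) x) with hr
  have hf : (fun y' : E m => diracLeft (fun x' : E m =>
      algebraMap ℝ (Cl m) (harmonicKernel (k + 1) x' y')) x) =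
      fun y' => eval y'.ofLp q • (vec y' * 1) - eval y'.ofLp r • vec x := by
    funext y'
    rw [diracLeft_harmonicKernel hm, hq, hr, smul_eval, smul_eval, map_mul, eval_sum_sq,
      eval_zonal_comm _ _ x, eval_zonal_comm _ _ x, mul_one]
    module
  have hd : ∀ j, partialDeriv j (fun y' : E m => eval y'.ofLp q • (vec y' * (1 : Cl m)) -
      eval y'.ofLp r • vec x) y = eval y.ofLp (pderiv j q) • vec y + eval y.ofLp q • e j -
        eval y.ofLp (pderiv j r) • vec x := fun j => by
    have h := HasDerivAt.fun_sub (hasLineDerivAt_eval_smul_vec_mul q 1 y j)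
      (hasLineDerivAt_eval_smul r (vec x) y j)
    simp only [mul_one] at h ⊢
    exact HasLineDerivAt.lineDeriv h
  have hq' : ∑ j, eval y.ofLp (pderiv j q) • (e j : Cl m) = ((m : ℝ) + 2 * k) • (m : ℝ) •
      (eval y.ofLp (zonal (mu m + 1 + 1) (k - 1) x) • vec x -
        (‖x‖ ^ 2 * eval y.ofLp (zonal (mu m + 1 + 1) (k - 2) x)) • vec y) := by
    simp only [hq, Derivation.map_smul, smul_eval, mul_smul]
    rw [← Finset.smul_sum, sum_pderiv_zonal_smul_e h1, two_mul_mu_add_one, mul_smul (‖x‖ ^ 2)]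
  have hr' : ∑ j, eval y.ofLp (pderiv j r) • (e j : Cl m) = ((m : ℝ) + 2 * k) •
      ((‖y‖ ^ 2) • (m : ℝ) • (eval y.ofLp (zonal (mu m + 1 + 1) (k - 2) x) • vec x -
        (‖x‖ ^ 2 * eval y.ofLp (zonal (mu m + 1 + 1) (k - 3) x)) • vec y) +
      (2 * eval y.ofLp (zonal (mu m + 1) (k - 1) x)) • vec y) := by
    have hj : ∀ j, eval y.ofLp (pderiv j r) • (e j : Cl m) = ((m : ℝ) + 2 * k) •
        ((‖y‖ ^ 2) • (eval y.ofLp (pderiv j (zonal (mu m + 1) (k - 1) x)) • e j) +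
          (2 * eval y.ofLp (zonal (mu m + 1) (k - 1) x)) • (y j • e j)) := fun j => by
      have hs : eval y.ofLp (pderiv j (∑ i : Fin m, X i ^ 2)) = 2 * y j := by
        simp [Derivation.leibniz_pow, pderiv_X, Pi.single_apply]
      rw [hr, Derivation.map_smul, smul_eval, Derivation.leibniz, map_add, smul_eq_mul, smul_eq_mul,
        map_mul, map_mul, eval_sum_sq, hs]
      module
    rw [Finset.sum_congr rfl fun j _ => hj j, ← Finset.smul_sum, Finset.sum_add_distrib,
      ← Finset.smul_sum, ← Finset.smul_sum, sum_pderiv_zonal_smul_e h1, two_mul_mu_add_one,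
      show (k : ℤ) - 1 - 1 = k - 2 by ring, show (k : ℤ) - 1 - 2 = k - 3 by ring,
      show ∑ j, y j • (e j : Cl m) = vec y from rfl]
  have hmk : (m : ℝ) + 2 * k ≠ 0 := by
    have : 0 < m := by lia
    positivity
  rw [monogenicKernel, hf, diracRight]
  simp only [hd, sub_mul, add_mul, smul_mul_assoc]
  rw [Finset.sum_sub_distrib, Finset.sum_add_distrib]
  have s1 : ∀ (f : Fin m → ℝ) (v : Cl m), ∑ j, f j • (v * e j) = v * ∑ j, f j • e j :=
    fun f v => by rw [Finset.mul_sum]; exact Finset.sum_congr rfl fun j _ => by rw [mul_smul_comm]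
  rw [s1, s1, ← Finset.smul_sum, sum_e_mul_e, hq', hr']
  simp only [mul_smul_comm, mul_sub, mul_add, vec_mul_self, vec_mul_vec_swap x y]
  rw [eval_zonal_comm _ _ x, eval_zonal_comm _ _ x]
  rw [hq, smul_eval]
  set s := inner ℝ x y
  set p := ‖x‖ ^ 2 * ‖y‖ ^ 2 with hp
  -- Euler's relation settles the coefficient of `1`, and the relation at index `k - 1` that of `x
  -- y`; each produces the second factor `m + 2k`.
  have hE := gegenbauerForm_euler s p h1 (k : ℤ)
  have hA := smul_gegenbauerForm_eq_sub s p h1 ((k : ℤ) - 1)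
  rw [show (k : ℤ) - 1 - 2 = k - 3 by ring] at hA
  have hz : ∀ ν n, eval y.ofLp (zonal ν n x) = gegenbauerForm ν n s p := fun ν n => by
    rw [← eval_zonal_comm, eval_zonal]
  simp only [hz]
  have hk := two_mul_mu_add_one (m := m)
  simp only [smul_eq_mul] at hE hA
  rw [hk] at hE
  have hA' : (2 * k - 2 + m : ℝ) * gegenbauerForm (mu m + 1) (k - 1) s p = m *
      (gegenbauerForm (mu m + 1 + 1) (k - 1) s p -
        p * gegenbauerForm (mu m + 1 + 1) (k - 3) s p) := by
    push_cast at hA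
    rw [← hk]
    linear_combination 2 * hA
  push_cast at hE
  match_scalars
  · field_simp
    linear_combination (-2) * hE + 2 * m * gegenbauerForm (mu m + 1 + 1) (k - 2) s p * hp
  · field_simp
    linear_combination (-1) * hA' + m * gegenbauerForm (mu m + 1 + 1) (k - 3) s p * hp

/-- Monogenicity of the closed form. -/
theorem diracLeft_monogenicKernel (hm : 3 ≤ m) (k : ℕ) (x y : E m) :
    diracLeft (fun x => monogenicKernel k x y) x = 0 := by
  have h0 := mu_pos hm
  have h1 : 0 < mu m + 1 := by linarith
  have hf : (fun x : E m => monogenicKernel k x y) =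
      fun x => eval x.ofLp (zonal (mu m + 1) k y) • (1 : Cl m) +
      eval x.ofLp (zonal (mu m + 1) (k - 1) y) • (vec x * vec y) :=
    funext fun x => monogenicKernel_eq hm k x y
  have hd : ∀ j, partialDeriv j (fun x : E m => monogenicKernel k x y) x =
      eval x.ofLp (pderiv j (zonal (mu m + 1) k y)) • (1 : Cl m) +
      (eval x.ofLp (pderiv j (zonal (mu m + 1) (k - 1) y)) • (vec x * vec y) +
        eval x.ofLp (zonal (mu m + 1) (k - 1) y) • (e j * vec y)) := fun j => by
    rw [hf]
    exact HasLineDerivAt.lineDeriv (HasDerivAt.fun_add (hasLineDerivAt_eval_smul _ 1 x j)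
      (hasLineDerivAt_eval_smul_vec_mul _ (vec y) x j))
  rw [diracLeft]
  simp only [hd, mul_add, mul_smul_comm, mul_one]
  rw [Finset.sum_add_distrib, Finset.sum_add_distrib]
  have s1 : ∀ (f : Fin m → ℝ) (v : Cl m), ∑ j, f j • (e j * v) = (∑ j, f j • e j) * v :=
    fun f v => by rw [Finset.sum_mul]; exact Finset.sum_congr rfl fun j _ => by rw [smul_mul_assoc]
  simp only [← mul_assoc (e _) (e _) (vec y)]
  rw [s1, ← Finset.smul_sum, ← Finset.sum_mul, sum_e_mul_e, sum_pderiv_zonal_smul_e h1,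
    sum_pderiv_zonal_smul_e h1, two_mul_mu_add_one]
  have e1 : vec y * (vec x * vec y) = (-2 * inner ℝ x y) • vec y + (‖y‖ ^ 2) • (vec x : Cl m) := by
    rw [← mul_assoc, vec_mul_vec_swap x y, sub_mul, mul_assoc, vec_mul_self, smul_mul_assoc,
      one_mul, mul_smul_comm, mul_one]
    module
  have e2 : vec x * (vec x * vec y) = (-‖x‖ ^ 2) • (vec y : Cl m) := by
    rw [← mul_assoc, vec_mul_self, smul_mul_assoc, one_mul]
  simp only [sub_mul, smul_mul_assoc, e1, e2, one_mul]
  -- The coefficient of `y` is this identity times `-m`; that of `x` cancels outright.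
  have hA := gegenbauerForm_eq_add_one (inner ℝ x y) (‖x‖ ^ 2 * ‖y‖ ^ 2) h1 ((k : ℤ) - 1)
  simp only [eval_zonal, show (k : ℤ) - 1 - 1 = k - 2 by ring,
    show (k : ℤ) - 1 - 2 = k - 3 by ring] at hA ⊢
  match_scalars
  · linear_combination (-m : ℝ) * hA
  · ring

end Dirac

/-! ### Clifford-valued homogeneous polynomials and their real components -/

section HomogeneousPolynomials

open MvPolynomial

variable {m : ℕ}

theorem isHomogeneousPolynomial_eval_smul {k : ℕ} {q : MvPolynomial (Fin m) ℝ}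
    (hq : q.IsHomogeneous k) (c : Cl m) :
    IsHomogeneousPolynomial k fun x : E m => eval x.ofLp q • c := by
  refine ⟨fun α => coeff (Finsupp.equivFunOnFinite.symm α) q • c, fun x => ?_⟩
  have h : eval x.ofLp q = ∑ α ∈ Finset.piAntidiag (Finset.univ : Finset (Fin m)) k,
      coeff (Finsupp.equivFunOnFinite.symm α) q * ∏ j, x j ^ α j := by
    rw [eval_eq']
    have hmap : ∑ d ∈ q.support, coeff d q * ∏ i, x.ofLp i ^ d i =
        ∑ α ∈ q.support.map Finsupp.equivFunOnFinite.toEmbedding,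
          coeff (Finsupp.equivFunOnFinite.symm α) q * ∏ j, x j ^ α j := by
      rw [Finset.sum_map]
      simp
    rw [hmap]
    refine Finset.sum_subset (fun α hα => ?_) fun α _ hα => ?_
    · obtain ⟨d, hd, rfl⟩ := Finset.mem_map.1 hα
      have := hq (mem_support_iff.1 hd)
      rw [Finset.mem_piAntidiag]
      refine ⟨?_, fun _ _ => Finset.mem_univ _⟩
      rw [← this]
      simp [Finsupp.weight_apply, Finsupp.sum_fintype]
    · have : coeff (Finsupp.equivFunOnFinite.symm α) q = 0 := by
        by_contra hne
        exact hα (Finset.mem_map.2 ⟨_, mem_support_iff.2 hne, by simp⟩)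
      rw [this, zero_mul]
  change eval x.ofLp q • c = _
  rw [h, Finset.sum_smul]
  refine Finset.sum_congr rfl fun α _ => ?_
  rw [smul_smul, mul_comm]

theorem IsHomogeneousPolynomial.add {k : ℕ} {P Q : E m → Cl m} (hP : IsHomogeneousPolynomial k P)
    (hQ : IsHomogeneousPolynomial k Q) : IsHomogeneousPolynomial k fun x => P x + Q x := by
  obtain ⟨p, hp⟩ := hP
  obtain ⟨q, hq⟩ := hQ
  refine ⟨fun α => p α + q α, fun x => ?_⟩
  simp only [hp, hq, smul_add, Finset.sum_add_distrib]

theorem isHomogeneousPolynomial_zero (k : ℕ) :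
    IsHomogeneousPolynomial k fun _ : E m => (0 : Cl m) :=
  ⟨fun _ => 0, fun x => by simp⟩

theorem isHomogeneousPolynomial_sum {ι : Type*} {k : ℕ} (s : Finset ι) {P : ι → E m → Cl m}
    (hP : ∀ i ∈ s, IsHomogeneousPolynomial k (P i)) :
    IsHomogeneousPolynomial k fun x => ∑ i ∈ s, P i x := by
  classical
  induction s using Finset.induction_on with
  | empty => simpa using isHomogeneousPolynomial_zero k
  | insert i s hi ih =>
    simp only [Finset.sum_insert hi]
    exact (hP i (Finset.mem_insert_self _ _)).add
      (ih fun j hj => hP j (Finset.mem_insert_of_mem hj))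

theorem isSphericalMonogenic_monogenicKernel (hm : 3 ≤ m) (k : ℕ) (y : E m) :
    IsSphericalMonogenic k fun x => monogenicKernel k x y := by
  refine ⟨?_, fun x => diracLeft_monogenicKernel hm k x y⟩
  simp only [monogenicKernel_eq hm]
  refine (isHomogeneousPolynomial_eval_smul (isHomogeneous_zonal _ k y) 1).add ?_
  -- For `k = 0` the index `-1` makes the bivector term vanish; otherwise a zonal factor of degree
  -- `k - 1` meets the linear factor `x`.
  rcases k with _ | k
  · rw [zonal_of_neg _ (by simp)]
    simpa using isHomogeneousPolynomial_zero 0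
  · have e1 : ((k + 1 : ℕ) : ℤ) - 1 = k := by push_cast; ring
    have h : ∀ x : E m, eval x.ofLp (zonal (mu m + 1) ((k + 1 : ℕ) - 1 : ℤ) y) •
        (vec x * vec y : Cl m) =
        ∑ j, eval x.ofLp (zonal (mu m + 1) k y * X j) • (e j * vec y) := fun x => by
      rw [vec, Finset.sum_mul, Finset.smul_sum, e1]
      refine Finset.sum_congr rfl fun j _ => ?_
      rw [smul_mul_assoc, smul_smul, map_mul, eval_X]
    simp only [h]
    exact isHomogeneousPolynomial_sum _ fun j _ => isHomogeneousPolynomial_eval_smul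
      ((isHomogeneous_zonal _ k y).mul (isHomogeneous_X ℝ j)) _

/-- All components of `N` are harmonic homogeneous polynomials of degree `l`. -/
def IsHarmonicPolynomial (l : ℕ) (N : E m → Cl m) : Prop :=
  ∀ φ : Cl m →ₗ[ℝ] ℝ, ∃ q : MvPolynomial (Fin m) ℝ, q.IsHomogeneous l ∧ laplacian q = 0 ∧
    ∀ x, φ (N x) = eval x.ofLp q

theorem IsHarmonicPolynomial.continuous {l : ℕ} {N : E m → Cl m} (hN : IsHarmonicPolynomial l N) :
    Continuous N := by
  have h : N = fun x => ∑ i, (Module.finBasis ℝ (Cl m)).coord i (N x) •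
      Module.finBasis ℝ (Cl m) i := by
    funext x
    simp only [Module.Basis.coord_apply]
    exact ((Module.finBasis ℝ (Cl m)).sum_repr (N x)).symm
  rw [h]
  refine continuous_finsetSum _ fun i _ => ?_
  obtain ⟨q, -, -, hq⟩ := hN ((Module.finBasis ℝ (Cl m)).coord i)
  simp only [hq]
  exact (continuous_eval_ofLp q).smul continuous_const

/-- The component of a homogeneous polynomial with coefficients `p`, as a polynomial. -/
def componentPoly (l : ℕ) (p : (Fin m → ℕ) → Cl m) (φ : Cl m →ₗ[ℝ] ℝ) : MvPolynomial (Fin m) ℝ :=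
  ∑ α ∈ Finset.piAntidiag (Finset.univ : Finset (Fin m)) l,
    monomial (Finsupp.equivFunOnFinite.symm α) (φ (p α))

theorem isHomogeneous_componentPoly (l : ℕ) (p : (Fin m → ℕ) → Cl m) (φ : Cl m →ₗ[ℝ] ℝ) :
    (componentPoly l p φ).IsHomogeneous l := by
  refine IsHomogeneous.sum _ _ _ fun α hα => isHomogeneous_monomial _ ?_
  rw [← (Finset.mem_piAntidiag.1 hα).1]
  simp [Finsupp.degree_eq_sum]

theorem eval_componentPoly (l : ℕ) (p : (Fin m → ℕ) → Cl m) (φ : Cl m →ₗ[ℝ] ℝ) (x : Fin m → ℝ) :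
    eval x (componentPoly l p φ) =
      φ (∑ α ∈ Finset.piAntidiag (Finset.univ : Finset (Fin m)) l, (∏ j, x j ^ α j) • p α) := by
  simp only [componentPoly, map_sum, eval_monomial, map_smul, smul_eq_mul]
  refine Finset.sum_congr rfl fun α _ => ?_
  rw [Finsupp.prod_fintype _ _ (by simp), mul_comm]
  simp

theorem componentPoly_add (l : ℕ) (p : (Fin m → ℕ) → Cl m) (φ ψ : Cl m →ₗ[ℝ] ℝ) :
    componentPoly l p (φ + ψ) = componentPoly l p φ + componentPoly l p ψ := by
  simp [componentPoly, Finset.sum_add_distrib]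

theorem componentPoly_smul (l : ℕ) (p : (Fin m → ℕ) → Cl m) (c : ℝ) (φ : Cl m →ₗ[ℝ] ℝ) :
    componentPoly l p (c • φ) = c • componentPoly l p φ := by
  simp [componentPoly, Finset.smul_sum, smul_monomial]

theorem hasLineDerivAt_linearMap_comp (φ : Cl m →ₗ[ℝ] ℝ) {f : E m → Cl m} {f' : Cl m} {x v : E m}
    (hf : HasLineDerivAt ℝ f f' x v) : HasLineDerivAt ℝ (fun x => φ (f x)) (φ f') x v :=
  φ.toContinuousLinearMap.hasFDerivAt.comp_hasDerivAt (0 : ℝ) hf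

variable {l : ℕ} {M : E m → Cl m} {p : (Fin m → ℕ) → Cl m}
  (hp : ∀ x : E m, M x = ∑ α ∈ Finset.piAntidiag (Finset.univ : Finset (Fin m)) l,
    (∏ j, x j ^ α j) • p α)

include hp

theorem linearMap_partialDeriv (φ : Cl m →ₗ[ℝ] ℝ) (j : Fin m) (x : E m) :
    φ (partialDeriv j M x) = eval x.ofLp (pderiv j (componentPoly l p φ)) := by
  have hd : LineDifferentiableAt ℝ M x (EuclideanSpace.single j 1) := by
    have hM : M = fun x : E m => ∑ α ∈ Finset.piAntidiag (Finset.univ : Finset (Fin m)) l,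
        eval x.ofLp (∏ j, X j ^ α j) • p α := by
      funext x
      rw [hp]
      simp
    rw [hM]
    exact HasLineDerivAt.lineDifferentiableAt (HasDerivAt.fun_sum fun α _ =>
      hasLineDerivAt_eval_smul (∏ j, X j ^ α j) (p α) x j)
  have h1 := hasLineDerivAt_linearMap_comp φ hd.hasLineDerivAt
  have h2 := hasLineDerivAt_eval (componentPoly l p φ) x j
  have h3 : (fun x : E m => φ (M x)) = fun x => eval x.ofLp (componentPoly l p φ) :=
    funext fun x => by rw [eval_componentPoly, hp]
  rw [h3] at h1
  exact HasLineDerivAt.unique h1 h2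

/-- The Dirac equation tested against `φ`, with left multiplication by `e_j` moved into the
functional. -/
theorem sum_pderiv_componentPoly (hM : ∀ x, diracLeft M x = 0) (φ : Cl m →ₗ[ℝ] ℝ) :
    ∑ j, pderiv j (componentPoly l p (φ ∘ₗ LinearMap.mulLeft ℝ (e j))) = 0 := by
  refine MvPolynomial.funext fun x => ?_
  have h := congrArg φ (hM (WithLp.toLp 2 x))
  rw [diracLeft, map_sum, map_zero] at h
  rw [map_sum, map_zero, ← h]
  refine Finset.sum_congr rfl fun j _ => ?_
  exact (linearMap_partialDeriv hp (φ ∘ₗ LinearMap.mulLeft ℝ (e j)) j (WithLp.toLp 2 x)).symm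

/-- The square of the Dirac operator is `-Δ`: mixed terms cancel by anticommutation, and `e_i² = -1`
leaves the pure second derivatives. -/
theorem laplacian_componentPoly (hM : ∀ x, diracLeft M x = 0) (φ : Cl m →ₗ[ℝ] ℝ) :
    laplacian (componentPoly l p φ) = 0 := by
  set c : Fin m → Fin m → MvPolynomial (Fin m) ℝ := fun i j =>
    pderiv i (pderiv j (componentPoly l p (φ ∘ₗ LinearMap.mulLeft ℝ (e i * e j)))) with hc
  have h0 : ∑ i, ∑ j, c i j = 0 := by
    refine Finset.sum_eq_zero fun i _ => ?_
    have h := sum_pderiv_componentPoly hp hM (φ ∘ₗ LinearMap.mulLeft ℝ (e i))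
    have h' := congrArg (pderiv i) h
    rw [map_sum, map_zero] at h'
    rw [← h']
    refine Finset.sum_congr rfl fun j _ => ?_
    simp only [hc]
    rw [LinearMap.mulLeft_mul, LinearMap.comp_assoc]
  have h1 : ∀ i j, i < j → c i j + c j i = 0 := fun i j hij => by
    simp only [hc]
    rw [pderiv_comm j i, ← map_add, ← map_add, ← componentPoly_add, ← LinearMap.comp_add]
    have : LinearMap.mulLeft ℝ (e i * e j : Cl m) + LinearMap.mulLeft ℝ (e j * e i) = 0 := by
      refine LinearMap.ext fun a => ?_
      simp only [LinearMap.add_apply, LinearMap.mulLeft_apply, ← add_mul]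
      rw [e_mul_e_of_ne hij.ne, add_neg_cancel, zero_mul, LinearMap.zero_apply]
    rw [this]
    simp [componentPoly]
  have h2 : ∀ i, c i i = -pderiv i (pderiv i (componentPoly l p φ)) := fun i => by
    have : φ ∘ₗ LinearMap.mulLeft ℝ (e i * e i : Cl m) = (-1 : ℝ) • φ := by
      refine LinearMap.ext fun a => ?_
      simp only [LinearMap.comp_apply, LinearMap.mulLeft_apply, e_mul_self, smul_mul_assoc, one_mul,
        map_smul, LinearMap.smul_apply]
    simp only [hc]
    rw [this, componentPoly_smul]
    simp
  rw [sum_sum_eq_sum_add_sum_Ioi, Finset.sum_eq_zero (f := fun j => ∑ k ∈ Finset.Ioi j, _)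
    fun i _ => Finset.sum_eq_zero fun j hj => h1 i j (Finset.mem_Ioi.1 hj), add_zero,
    Finset.sum_congr rfl fun i _ => h2 i, Finset.sum_neg_distrib, neg_eq_zero] at h0
  rw [laplacian_apply, h0]

end HomogeneousPolynomials

/-! ### Integrals of the kernel against spherical monogenics -/

section SphericalMonogenics

open MvPolynomial

variable {m l : ℕ} {M : E m → Cl m}

theorem IsSphericalMonogenic.isHarmonicPolynomial (hM : IsSphericalMonogenic l M) :
    IsHarmonicPolynomial l M := by
  obtain ⟨⟨p, hp⟩, hM⟩ := hM
  exact fun φ => ⟨componentPoly l p φ, isHomogeneous_componentPoly l p φ,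
    laplacian_componentPoly hp hM φ, fun x => by rw [eval_componentPoly, hp]⟩

/-- `Δ(x M) = x ΔM + 2 ∂M`, and both terms vanish. -/
theorem IsSphericalMonogenic.isHarmonicPolynomial_vec_mul (hM : IsSphericalMonogenic l M) :
    IsHarmonicPolynomial (l + 1) fun x => vec x * M x := by
  obtain ⟨⟨p, hp⟩, hM⟩ := hM
  refine fun φ => ⟨∑ j, X j * componentPoly l p (φ ∘ₗ LinearMap.mulLeft ℝ (e j)), ?_, ?_,
    fun x => ?_⟩
  · refine IsHomogeneous.sum _ _ _ fun j _ => ?_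
    rw [add_comm]
    exact (isHomogeneous_X ℝ j).mul (isHomogeneous_componentPoly l p _)
  · rw [map_sum]
    simp only [laplacian_X_mul, laplacian_componentPoly hp hM, mul_zero, zero_add]
    rw [← Finset.mul_sum, sum_pderiv_componentPoly hp hM, mul_zero]
  · simp only [vec, Finset.sum_mul, map_sum]
    refine Finset.sum_congr rfl fun j _ => ?_
    rw [map_mul (eval _), eval_X, eval_componentPoly, smul_mul_assoc, map_smul, hp]
    rfl

/-- The scalar Funk–Hecke formula, applied to every component; real functionals separate points of
the Clifford algebra. -/
theorem sphereMean_zonal_smul (hm : 3 ≤ m) {N : E m → Cl m} (hN : IsHarmonicPolynomial l N)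
    (n : ℤ) (y : E m) :
    (sphereArea m)⁻¹ • ∫ x : Metric.sphere (0 : E m) 1,
        eval x.1.ofLp (zonal (mu m + 1) n y) • N x ∂((volume : Measure (E m)).toSphere) =
      evenPow (‖y‖ ^ 2) (n - l) • N y := by
  rw [← sub_eq_zero, ← Module.forall_dual_apply_eq_zero_iff ℝ]
  intro φ
  obtain ⟨q, hq, hΔ, hφ⟩ := hN φ
  have hint : Integrable (fun x : Metric.sphere (0 : E m) 1 =>
      eval x.1.ofLp (zonal (mu m + 1) n y) • N x) (volume : Measure (E m)).toSphere :=
    integrable_sphere ((continuous_eval_ofLp _).smul hN.continuous)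
  have h := φ.toContinuousLinearMap.integral_comp_comm hint
  simp only [LinearMap.coe_toContinuousLinearMap'] at h
  rw [map_sub, map_smul, map_smul, ← h, hφ y, sub_eq_zero, smul_eq_mul, smul_eq_mul,
    ← sphereMean_zonal_add_one_mul hm hq hΔ, sphereMean]
  congr 2
  funext x
  rw [map_smul, hφ, map_mul, smul_eq_mul]

theorem star_monogenicKernel (hm : 3 ≤ m) (k : ℕ) (x y : E m) :
    star (monogenicKernel k x y) = eval x.ofLp (zonal (mu m + 1) k y) • 1 +
      eval x.ofLp (zonal (mu m + 1) (k - 1) y) • (vec y * vec x) := by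
  have h : (-vec y : Cl m) * -vec x = vec y * vec x := by
    rw [← neg_one_smul ℝ (vec y), ← neg_one_smul ℝ (vec x), smul_mul_smul_comm]
    norm_num
  rw [monogenicKernel_eq hm, star_add, star_smul, star_smul, star_mul, star_vec, star_vec,
    h, star_one, star_trivial, star_trivial]

/-- Integrals against the kernel split into two zonal integrals. -/
theorem sphereInner_monogenicKernel (hm : 3 ≤ m) (k : ℕ) (y : E m) {l' : ℕ} {N N' : E m → Cl m}
    (hN : IsHarmonicPolynomial l N) (hN' : IsHarmonicPolynomial l' N')
    (hx : ∀ x : E m, ‖x‖ = 1 → vec x * N x = N' x) :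
    sphereInner (fun x => monogenicKernel k x y) N =
      evenPow (‖y‖ ^ 2) (k - l) • N y + vec y * (evenPow (‖y‖ ^ 2) (k - 1 - l') • N' y) := by
  have hint : Integrable (fun x : Metric.sphere (0 : E m) 1 =>
      eval x.1.ofLp (zonal (mu m + 1) k y) • N x) (volume : Measure (E m)).toSphere :=
    integrable_sphere ((continuous_eval_ofLp _).smul hN.continuous)
  have hint' : Integrable (fun x : Metric.sphere (0 : E m) 1 =>
      eval x.1.ofLp (zonal (mu m + 1) (k - 1) y) • N' x) (volume : Measure (E m)).toSphere :=
    integrable_sphere ((continuous_eval_ofLp _).smul hN'.continuous)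
  have hL := (LinearMap.mulLeft ℝ (vec y : Cl m)).toContinuousLinearMap.integral_comp_comm hint'
  simp only [LinearMap.coe_toContinuousLinearMap', LinearMap.mulLeft_apply] at hL
  have hL' := (LinearMap.mulLeft ℝ (vec y : Cl m)).toContinuousLinearMap.integrable_comp hint'
  simp only [LinearMap.coe_toContinuousLinearMap', LinearMap.mulLeft_apply] at hL'
  rw [← sphereMean_zonal_smul hm hN, ← sphereMean_zonal_smul hm hN', mul_smul_comm, ← hL,
    ← smul_add, ← integral_add hint hL', sphereInner]
  congr 2
  funext x
  rw [star_monogenicKernel hm, add_mul, smul_mul_assoc, one_mul, smul_mul_assoc, mul_assoc,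
    hx x (norm_eq_of_mem_sphere x), mul_smul_comm]

end SphericalMonogenics

/-- The scalar part of `x y` is `-⟨x, y⟩`; Euler's relation plus `2μ` times the parameter shift,
both at `μ`, turns the resulting combination into a multiple of `C_k^μ`. -/
theorem monogenicKernel_eq_gegenbauer {m : ℕ} (hm : 3 ≤ m) (k : ℕ) (x y : E m) :
    monogenicKernel k x y =
      algebraMap ℝ (Cl m) ((2 * mu m + k) / (2 * mu m) * ‖x‖ ^ k * ‖y‖ ^ k *
        gegenbauer k (mu m) (angle x y)) +
      bivectorCoeff k x y • wedge x y := by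
  have h0 := mu_pos hm
  have hb : bivectorCoeff k x y =
      gegenbauerForm (mu m + 1) (k - 1) (inner ℝ x y) (‖x‖ ^ 2 * ‖y‖ ^ 2) := by
    rcases k with _ | k
    · rw [gegenbauerForm_of_neg _ _ _ (by simp)]
      rfl
    · rw [bivectorCoeff, norm_pow_mul_gegenbauer]
      congr 1
      push_cast
      ring
  have hc : (2 * mu m + k) / (2 * mu m) * ‖x‖ ^ k * ‖y‖ ^ k * gegenbauer k (mu m) (angle x y) =
      gegenbauerForm (mu m + 1) k (inner ℝ x y) (‖x‖ ^ 2 * ‖y‖ ^ 2) -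
        inner ℝ x y * gegenbauerForm (mu m + 1) (k - 1) (inner ℝ x y) (‖x‖ ^ 2 * ‖y‖ ^ 2) := by
    have hE := gegenbauerForm_euler (inner ℝ x y) (‖x‖ ^ 2 * ‖y‖ ^ 2) h0 k
    have hA := gegenbauerForm_eq_add_one (inner ℝ x y) (‖x‖ ^ 2 * ‖y‖ ^ 2) h0 k
    simp only [smul_eq_mul, Int.cast_natCast] at hE
    rw [mul_assoc, mul_assoc, ← mul_assoc (‖x‖ ^ k), norm_pow_mul_gegenbauer]
    field_simp
    linear_combination hE + 2 * mu m * hA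
  rw [hb, hc, monogenicKernel_eq hm, eval_zonal, eval_zonal, vec_mul_vec_eq_wedge,
    Algebra.algebraMap_eq_smul_one]
  module

end CliffordAnalysis

end

theorem theorem3p4 (m : ℕ) (hm : 3 ≤ m) (k : ℕ) :
    (∀ x y : E m,
      monogenicKernel k x y =
        algebraMap ℝ (Cl m) ((2 * mu m + k) / (2 * mu m) * ‖x‖ ^ k * ‖y‖ ^ k *
          gegenbauer k (mu m) (angle x y)) +
        bivectorCoeff k x y • wedge x y) ∧
    (∀ y : E m, IsSphericalMonogenic k (fun x => monogenicKernel k x y)) ∧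
    (∀ (l : ℕ) (M : E m → Cl m), IsSphericalMonogenic l M →
      (∀ y : E m, sphereInner (fun x => monogenicKernel k x y) M = if k = l then M y else 0) ∧
      (∀ y : E m, sphereInner (fun x => monogenicKernel k x y) (fun x => vec x * M x) = 0)) := by
  refine ⟨monogenicKernel_eq_gegenbauer hm k, isSphericalMonogenic_monogenicKernel hm k,
    fun l M hM => ⟨fun y => ?_, fun y => ?_⟩⟩
  -- Since `y y = -|y|²`, the second mean is `-|y|²` times the even power two steps lower;
  -- `evenPow_eq` leaves only the Kronecker delta.
  · rw [sphereInner_monogenicKernel hm k y hM.isHarmonicPolynomial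
      hM.isHarmonicPolynomial_vec_mul (fun x _ => rfl), evenPow_eq, mul_smul_comm, ← mul_assoc,
      vec_mul_self, smul_mul_assoc, one_mul,
      show (k : ℤ) - 1 - (l + 1 : ℕ) = k - l - 2 by push_cast; ring]
    by_cases h : k = l
    · rw [if_pos h, if_pos (by lia)]
      module
    · rw [if_neg h, if_neg (by lia)]
      module
  -- On the sphere `x x M` equals `-M`, harmonic of degree `l`. Both means then carry the same even
  -- power, of index `k - 1 - l`, with opposite signs.
  · have hneg : IsHarmonicPolynomial l fun x => (-1 : ℝ) • M x := fun φ => by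
      obtain ⟨q, hq, hΔ, hφ⟩ := hM.isHarmonicPolynomial ((-1 : ℝ) • φ)
      exact ⟨q, hq, hΔ, fun x => by rw [← hφ]; simp⟩
    rw [sphereInner_monogenicKernel hm k y hM.isHarmonicPolynomial_vec_mul hneg (fun x hx => by
      rw [← mul_assoc, vec_mul_self, hx, smul_mul_assoc, one_mul, one_pow]), mul_smul_comm,
      mul_smul_comm, show (k : ℤ) - (l + 1 : ℕ) = k - 1 - l by push_cast; ring]
    module
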